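/- Let $T=(\omega_1,<_T)$ be an $\omega_1$-tree (a tree of height $\omega_1$ with countable levels, with underlying set $\omega_1$) and let $\kappa=(2^{\omega_1})^+$. An Aronszajn subtree of $T$ is a downward closed $A\subseteq T$ which, with the inherited order, is an $\omega_1$-tree without uncountable chains. A countable $M\prec H_\kappa$ with $T\in M$ captures $x\in T$ if there is a chain $c\subseteq T$ with $c\in M$ which contains every $y\le_T x$ of height less than $M\cap\omega_1$. Let $x \in T$, let $\theta$ be a regular cardinal, and let $N\prec H_\theta$ be countable with $T\in N$. For $\Sigma\subseteq[H_\kappa]^\omega$, say that $\Sigma$ witnesses that $x$ is weakly external to $N$ if $\Sigma$ is stationary, $\Sigma\in N$ and no $M\in\Sigma\cap N$ captures $x$; $x$ is weakly external to $N$ if some stationary $\Sigma$ witnesses this, and external to $N$ if some $\Sigma$ which is a club in $[H_\kappa]^\omega$ does. (1) Let $\Sigma\subseteq[H_\kappa]^\omega$ be stationary, and suppose that for all large enough regular cardinals $\theta$ there are $x\in T$ and a countable $N\prec H_\theta$ with $T,\Sigma\in N$ such that $\Sigma$ witnesses that $x$ is weakly external to $N$. Then $T$ has an Aronszajn subtree.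 (2) The following are equivalent: (a) $T$ has an Aronszajn subtree; (b) for all large enough regular cardinals $\theta$ there are $x\in T$ and a countable $N\prec H_\theta$ with $T\in N$ such that $x$ is external to $N$; (c) for all large enough regular cardinals $\theta$ there are $x\in T$ and a countable $N\prec H_\theta$ with $T\in N$ such that $x$ is weakly external to $N$. -/

import Mathlib

universe u

namespace AronszajnSubtrees

open Cardinal Ordinal ZFSet FirstOrder

/-! ### Hereditarily small sets and elementary submodels -/

/-- The symbols of the language of set theory: one binary relation symbol. -/
inductive SetRel : ℕ → Type
  | mem : SetRel 2

/-- The first-order language `{∈}`. -/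
def setLanguage : Language := ⟨fun _ => Empty, SetRel⟩

/-- Every class of sets is a structure for `{∈}`, with the true membership relation. -/
instance memStructure (A : Set ZFSet.{u}) : setLanguage.Structure A where
  funMap f := f.elim
  RelMap r := match r with
    | .mem => fun v => (v 0 : ZFSet.{u}) ∈ (v 1 : ZFSet.{u})

/-- `H θ` consists of the sets whose transitive closure has fewer than `θ` elements, equivalently
of the sets that are included in a transitive set with fewer than `θ` elements. -/
def H (θ : Cardinal.{u}) : Set ZFSet.{u} :=
  {x | ∃ t : ZFSet.{u}, t.IsTransitive ∧ x ⊆ t ∧ t.card < θ}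

/-- `N` is a countable elementary submodel of `(H θ, ∈)`. -/
def IsCountableModel (θ : Cardinal.{u}) (N : ZFSet.{u}) : Prop :=
  N.card ≤ ℵ₀ ∧
    ∃ S : setLanguage.ElementarySubstructure (H θ), Subtype.val '' (S : Set (H θ)) = (N : Set ZFSet.{u})

/-! ### Clubs and stationary sets of countable sets -/

/-- `[X]^ω`: the collection of all countably infinite subsets of `X`. -/
def countableSubsets (X : Set ZFSet.{u}) : Set ZFSet.{u} :=
  {a | (a : Set ZFSet.{u}) ⊆ X ∧ a.card = ℵ₀}

/-- `C` is closed and unbounded in `[X]^ω`. -/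
structure IsClubOf (X C : Set ZFSet.{u}) : Prop where
  subset : C ⊆ countableSubsets X
  unbounded : ∀ a ∈ countableSubsets X, ∃ c ∈ C, a ⊆ c
  closed : ∀ f : ℕ → ZFSet.{u}, (∀ n, f n ∈ C) → (∀ n, f n ⊆ f (n + 1)) → ZFSet.iUnion f ∈ C

/-- `S` is a stationary subset of `[X]^ω`. -/
def IsStationaryOf (X S : Set ZFSet.{u}) : Prop :=
  S ⊆ countableSubsets X ∧ ∀ C : Set ZFSet.{u}, IsClubOf X C → (S ∩ C).Nonempty

/-! ### Trees -/

/-- `y` is below `x` in the order coded by the set of ordered pairs `R`. -/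
def Below (R y x : ZFSet.{u}) : Prop := pair y x ∈ R

/-- The set of predecessors in `X` of `x`. -/
abbrev Preds (X R x : ZFSet.{u}) : Type (u + 1) := {y : ZFSet.{u} // y ∈ X ∧ Below R y x}

/-- `X` with the strict order coded by `R` is a tree. -/
structure IsTree (X R : ZFSet.{u}) : Prop where
  irrefl : ∀ x ∈ X, ¬ Below R x x
  trans : ∀ x ∈ X, ∀ y ∈ X, ∀ z ∈ X, Below R x y → Below R y z → Below R x z
  wellOrdered : ∀ x ∈ X, IsWellOrder (Preds X R x) (fun y z => Below R y.1 z.1)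

/-- `x` has height `α` in the tree `(X, R)`: its predecessors have order type `α`. -/
def HasHeight (X R x : ZFSet.{u}) (α : Ordinal.{u}) : Prop :=
  Nonempty ((fun y z : Preds X R x => Below R y.1 z.1) ≃r
    (fun β γ : Set.Iio α => β.1 < γ.1))

/-- The `α`-th level of the tree `(X, R)`. -/
def level (X R : ZFSet.{u}) (α : Ordinal.{u}) : Set ZFSet.{u} :=
  {x | x ∈ X ∧ HasHeight X R x α}

/-- `(X, R)` is an `ω₁`-tree: a tree of height `ω₁` all of whose levels are countable. -/
structure IsOmegaOneTree (X R : ZFSet.{u}) : Prop where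
  isTree : IsTree X R
  exists_height : ∀ x ∈ X, ∃ α < ω_ 1, HasHeight X R x α
  level_nonempty : ∀ α < ω_ 1, (level X R α).Nonempty
  level_countable : ∀ α < ω_ 1, (level X R α).Countable

/-- `c` is a chain of the tree `(X, R)`. -/
def IsTreeChain (X R c : ZFSet.{u}) : Prop :=
  c ⊆ X ∧ ∀ y ∈ c, ∀ z ∈ c, y = z ∨ Below R y z ∨ Below R z y

/-- `(X, R)` is an Aronszajn tree: an `ω₁`-tree without uncountable chains. -/
def IsAronszajnTree (X R : ZFSet.{u}) : Prop :=
  IsOmegaOneTree X R ∧ ∀ c, IsTreeChain X R c → c.card ≤ ℵ₀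

/-- `A` is an Aronszajn subtree of `(X, R)`: a downward closed subset of `X` which is an Aronszajn
tree with the inherited order. -/
def IsAronszajnSubtree (X R A : ZFSet.{u}) : Prop :=
  A ⊆ X ∧ (∀ x ∈ A, ∀ y ∈ X, Below R y x → y ∈ A) ∧ IsAronszajnTree A R

/-! ### Trees on `ω₁`, capturing and external elements -/

/-- The von Neumann ordinal `ω₁`. -/
noncomputable def omega1 : ZFSet.{u} := (ω_ 1).toZFSet

/-- The tree `(ω₁, R)` as a set. -/
noncomputable def treeOn (R : ZFSet.{u}) : ZFSet.{u} := pair omega1 R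

/-- The cardinal `(2^{ω₁})⁺`. -/
noncomputable def kappa : Cardinal.{u} := Order.succ (2 ^ ℵ_ 1)

/-- The countable model `M ≺ H κ`, with `T = (ω₁, R)` in `M`, captures `x`: there is a chain `c` of
`T` in `M` such that every `y ≤ x` whose height is less than `M ∩ ω₁` is in `c`. As `M ∩ ω₁` is an
ordinal, the condition on the height `α` of `y` is that `α ∈ M`. -/
def Captures (κ : Cardinal.{u}) (R M x : ZFSet.{u}) : Prop :=
  IsCountableModel κ M ∧ treeOn R ∈ M ∧
    ∃ c ∈ M, IsTreeChain omega1 R c ∧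
      ∀ y ∈ omega1, (y = x ∨ Below R y x) →
        ∀ α < ω_ 1, HasHeight omega1 R y α → α.toZFSet ∈ M → y ∈ c

/-- `N` is a countable elementary submodel of `H θ` with `T = (ω₁, R)` and `S` in `N`, and no
`M ∈ S ∩ N` captures `x`. -/
def ExternalVia (θ : Cardinal.{u}) (R x N S : ZFSet.{u}) : Prop :=
  IsCountableModel θ N ∧ treeOn R ∈ N ∧ S ∈ N ∧ ∀ M ∈ S, M ∈ N → ¬ Captures kappa R M x

/-- `x` is weakly external to `N ≺ H θ`. -/
def IsWeaklyExternal (θ : Cardinal.{u}) (R x N : ZFSet.{u}) : Prop :=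
  ∃ S : ZFSet.{u}, IsStationaryOf (H kappa) S ∧ ExternalVia θ R x N S

/-- `x` is external to `N ≺ H θ`. -/
def IsExternal (θ : Cardinal.{u}) (R x N : ZFSet.{u}) : Prop :=
  ∃ S : ZFSet.{u}, IsClubOf (H kappa) S ∧ ExternalVia θ R x N S

/-- `P θ` holds for all large enough regular cardinals `θ`. -/
def ForLargeRegular (P : Cardinal.{u} → Prop) : Prop :=
  ∃ θ₀ : Cardinal.{u}, ∀ θ : Cardinal.{u}, θ₀ ≤ θ → θ.IsRegular → P θ

end AronszajnSubtrees

open AronszajnSubtrees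

namespace AronszajnSubtrees

open Cardinal Ordinal ZFSet FirstOrder

/-! ### Sizes of sets -/

/-! Suppose first that `A` is an Aronszajn subtree. Every chain `c` of `T` meets `A` in a countable
set, so the nodes of `c ∩ A` have heights below some `β c < ω₁`. The countable `M` closed under `β`
form a club `S`. Given a countable `N` with `S, T ∈ N`, pick `x ∈ A` at a level above all countable
ordinals that occur in members of `S ∩ N`. If some `c ∈ M ∈ S ∩ N` captured `x`, it would contain
the node of height `β c ∈ M` below `x`, which lies in `A`, against the choice of `β c`. So `x` is
external to `N` (`IsAronszajnSubtree.exists_external`). Clubs are stationary, hence external implies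
weakly external.

Conversely, let `S` be stationary and let `U` be the set of nodes `y` that no sufficiently closed `M
∈ S` with the height of `y` outside `M` captures (`uncaptured`). It is downward closed: a chain in
`M` that captures such a `y` also captures everything above `y` (`Captured.of_le`). It has no
uncountable chain: the downward closure of one would belong to some closed `M ∈ S` and would capture
all nodes of the chain with height outside `M`. So if `T` has no Aronszajn subtree, `U` misses a
level `α`. The models that capture the countably many nodes of level `α` capture all nodes above
them, and countably many further models take care of the nodes below level `α`
(`exists_seq_captured`). Thus a countable sequence in `S` captures all nodes. By elementarity such a
sequence exists in `N`, and so do its terms, since `N` contains every natural number. Hence every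
`x` is captured by a member of `S ∩ N`, and no `x` is weakly external via `S`. A single regular `θ ≥
κ` suffices for this direction.

The reflected statement must say that the terms of the sequence are elementary in `H κ`. Syntax is
not coded for this: a family `D` of classes closed under the formula-building operations stands for
the formulas, and elementarity becomes the Tarski-Vaught test for `D`. The whole statement
(`CapturedByCountable`) then has only bounded quantifiers and means the same in the transitive class
`H θ` as in the universe. -/

theorem exists_coe_eq (s : Set ZFSet.{u}) [Small.{u} s] : ∃ x : ZFSet.{u}, (x : Set ZFSet) = s :=
  ⟨range (Subtype.val : s → ZFSet.{u}), by simp⟩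

theorem card_le_aleph0_iff {x : ZFSet.{u}} : x.card ≤ ℵ₀ ↔ (x : Set ZFSet).Countable := by
  rw [← le_aleph0_iff_set_countable, ← Cardinal.lift_le.{u + 1}, ← cardinalMk_coe_sort, lift_aleph0]
  rfl

theorem card_eq_aleph0_iff {x : ZFSet.{u}} :
    x.card = ℵ₀ ↔ (x : Set ZFSet).Countable ∧ (x : Set ZFSet).Infinite := by
  rw [← card_le_aleph0_iff, ← Set.infinite_coe_iff, Cardinal.infinite_iff]
  have h : #(x : Set ZFSet) = lift.{u + 1, u} x.card := cardinalMk_coe_sort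
  rw [h, aleph0_le_lift, le_antisymm_iff]

theorem exists_of_countable {s : Set ZFSet.{u}} (hs : s.Countable) :
    ∃ x : ZFSet.{u}, (x : Set ZFSet) = s ∧ x.card ≤ ℵ₀ := by
  have := hs.to_subtype
  obtain ⟨x, hx⟩ := exists_coe_eq s
  exact ⟨x, hx, card_le_aleph0_iff.2 (hx ▸ hs)⟩

theorem card_prod_le (x y : ZFSet.{u}) : (prod x y).card ≤ x.card * y.card := by
  rw [← Cardinal.lift_le.{u + 1}, Cardinal.lift_mul, ← cardinalMk_coe_sort, ← cardinalMk_coe_sort,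
    ← cardinalMk_coe_sort, Cardinal.mul_def]
  refine mk_le_of_surjective
    (f := fun p => ⟨pair p.1.1 p.2.1, pair_mem_prod.2 ⟨p.1.2, p.2.2⟩⟩) ?_
  rintro ⟨z, hz⟩
  obtain ⟨a, ha, b, hb, rfl⟩ := mem_prod.1 hz
  exact ⟨(⟨a, ha⟩, ⟨b, hb⟩), rfl⟩

/-- The ranks of the elements of a transitive set form an initial segment. -/
theorem exists_rank_eq {t : ZFSet.{u}} (ht : t.IsTransitive) {o : Ordinal.{u}} (ho : o < t.rank) :
    ∃ y ∈ t, y.rank = o := by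
  have hne : {y | y ∈ t ∧ o ≤ y.rank}.Nonempty := by
    obtain ⟨y, hy, h⟩ := lt_rank_iff.1 ho
    exact ⟨y, hy, h⟩
  obtain ⟨y, ⟨hy, hoy⟩, hmin⟩ := WellFounded.has_min ZFSet.mem_wf _ hne
  refine ⟨y, hy, le_antisymm ?_ hoy⟩
  by_contra! h
  obtain ⟨z, hz, hoz⟩ := lt_rank_iff.1 h
  exact hmin z ⟨ht y hy hz, hoz⟩ hz

theorem card_rank_le {t : ZFSet.{u}} (ht : t.IsTransitive) : t.rank.card ≤ t.card := by
  rw [← Cardinal.lift_le.{u + 1}, ← Cardinal.mk_Iio_ordinal, ← cardinalMk_coe_sort]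
  refine mk_le_of_surjective (f := fun y : t => (⟨y.1.rank, rank_lt_of_mem y.2⟩ : Set.Iio t.rank)) ?_
  rintro ⟨o, ho⟩
  obtain ⟨y, hy, rfl⟩ := exists_rank_eq ht ho
  exact ⟨⟨y, hy⟩, rfl⟩

/-! ### Closure properties of `H θ` -/

variable {θ : Cardinal.{u}}

theorem mem_H_of_mem {x y : ZFSet.{u}} (hx : x ∈ H θ) (hy : y ∈ x) : y ∈ H θ := by
  obtain ⟨t, ht, hxt, hc⟩ := hx
  exact ⟨t, ht, ht y (hxt hy), hc⟩

theorem mem_H_of_subset {x y : ZFSet.{u}} (hx : x ∈ H θ) (hy : y ⊆ x) : y ∈ H θ := by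
  obtain ⟨t, ht, hxt, hc⟩ := hx
  exact ⟨t, ht, fun _ h => hxt (hy h), hc⟩

theorem H_mono {μ : Cardinal.{u}} (h : μ ≤ θ) : H μ ⊆ H θ :=
  fun _ ⟨t, ht, hxt, hc⟩ => ⟨t, ht, hxt, hc.trans_le h⟩

theorem card_lt_of_mem_H {x : ZFSet.{u}} (hx : x ∈ H θ) : x.card < θ := by
  obtain ⟨t, -, hxt, hc⟩ := hx
  exact (card_mono hxt).trans_lt hc

/-- By regularity, the union of fewer than `θ` transitive sets of size less than `θ` again has size
less than `θ`. -/
theorem mem_H_of_card_lt (hθ : θ.IsRegular) {x : ZFSet.{u}} (hx : (x : Set ZFSet) ⊆ H θ)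
    (hc : x.card < θ) : x ∈ H θ := by
  have hx' : ∀ y ∈ x, ∃ t : ZFSet.{u}, t.IsTransitive ∧ y ⊆ t ∧ t.card < θ := fun y hy => hx hy
  choose! t ht hxt htc using hx'
  let f : Shrink x → ZFSet := fun i => t ((equivShrink x).symm i)
  have hf (y) (hy : y ∈ x) : ∃ i, f i = t y := ⟨equivShrink x ⟨y, hy⟩, by simp [f]⟩
  refine ⟨x ∪ iUnion f, ?_, fun y hy => mem_union.2 (Or.inl hy), ?_⟩
  · intro y hy z hz
    rw [mem_union, mem_iUnion] at hy ⊢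
    right
    obtain hy | ⟨i, hi⟩ := hy
    · obtain ⟨i, hi⟩ := hf y hy
      exact ⟨i, (congrArg (z ∈ ·) hi).mpr (hxt y hy hz)⟩
    · exact ⟨i, ht _ ((equivShrink x).symm i).2 y hi hz⟩
  · refine card_union_le.trans_lt (add_lt_of_lt hθ.aleph0_le hc ?_)
    have h := lift_card_iUnion_le_sum_card (f := f)
    rw [Cardinal.lift_id] at h
    exact h.trans_lt (sum_lt_of_isRegular hθ hc fun i => htc _ ((equivShrink x).symm i).2)

theorem mem_H_of_countable (hθ : θ.IsRegular) (h0 : ℵ₀ < θ) {x : ZFSet.{u}}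
    (hx : (x : Set ZFSet) ⊆ H θ) (hc : (x : Set ZFSet).Countable) : x ∈ H θ :=
  mem_H_of_card_lt hθ hx ((card_le_aleph0_iff.2 hc).trans_lt h0)

theorem empty_mem_H (hθ : θ.IsRegular) : ∅ ∈ H θ :=
  mem_H_of_card_lt hθ (by simp) (by simpa using aleph0_pos.trans_le hθ.aleph0_le)

theorem upair_mem_H (hθ : θ.IsRegular) {x y : ZFSet.{u}} (hx : x ∈ H θ) (hy : y ∈ H θ) :
    ({x, y} : ZFSet.{u}) ∈ H θ := by
  refine mem_H_of_card_lt hθ ?_ (lt_of_le_of_lt (card_insert_le.trans ?_)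
    ((natCast_lt_aleph0 (n := 2)).trans_le hθ.aleph0_le))
  · intro z hz
    rcases mem_pair.1 hz with rfl | rfl <;> assumption
  · rw [card_singleton, one_add_one_eq_two]
    simp

theorem pair_mem_H (hθ : θ.IsRegular) {x y : ZFSet.{u}} (hx : x ∈ H θ) (hy : y ∈ H θ) :
    pair x y ∈ H θ := by
  refine upair_mem_H hθ ?_ (upair_mem_H hθ hx hy)
  rw [← pair_eq_singleton]
  exact upair_mem_H hθ hx hx

theorem fst_mem_H {x y : ZFSet.{u}} (h : pair x y ∈ H θ) : x ∈ H θ :=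
  mem_H_of_mem (mem_H_of_mem h (y := {x}) (by simp [pair])) (by simp)

theorem snd_mem_H {x y : ZFSet.{u}} (h : pair x y ∈ H θ) : y ∈ H θ :=
  mem_H_of_mem (mem_H_of_mem h (y := {x, y}) (by simp [pair])) (by simp)

theorem toZFSet_mem_H {α : Ordinal.{u}} (h : α.card < θ) : α.toZFSet ∈ H θ :=
  ⟨_, (isOrdinal_toZFSet α).isTransitive, fun _ h => h, by simpa using h⟩

theorem exists_forall_mem_H (x : ZFSet.{u}) : ∃ μ : Cardinal.{u}, ∀ θ, μ ≤ θ → x ∈ H θ :=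
  ⟨Order.succ (vonNeumann x.rank).card, fun _ h => ⟨_, isTransitive_vonNeumann _,
    subset_vonNeumann_self x, (Order.lt_succ _).trans_le h⟩⟩

theorem rank_lt_of_mem_H {x : ZFSet.{u}} (hx : x ∈ H θ) : x.rank < θ.ord := by
  obtain ⟨t, ht, hxt, hc⟩ := hx
  exact (rank_mono hxt).trans_lt (lt_ord.2 ((card_rank_le ht).trans_lt hc))

/-- `H θ` as a set. -/
noncomputable def hset (θ : Cardinal.{u}) : ZFSet.{u} := (vonNeumann θ.ord).sep (· ∈ H θ)

@[simp]
theorem mem_hset {x : ZFSet.{u}} : x ∈ hset θ ↔ x ∈ H θ := by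
  simp only [hset, mem_sep, mem_vonNeumann, and_iff_right_iff_imp]
  exact rank_lt_of_mem_H

theorem natCast_toZFSet_mem_H (hθ : θ.IsRegular) (n : ℕ) : (n : Ordinal.{u}).toZFSet ∈ H θ :=
  toZFSet_mem_H (by simpa using (natCast_lt_aleph0 (n := n)).trans_le hθ.aleph0_le)

theorem H_infinite (hθ : θ.IsRegular) : (H θ).Infinite :=
  Set.infinite_of_injective_forall_mem (f := fun n : ℕ => (n : Ordinal.{u}).toZFSet)
    (fun m n h => by simpa using toZFSet_injective h) (natCast_toZFSet_mem_H hθ)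

/-! ### The cardinal `(2^{ω₁})⁺` and the set `ω₁` -/

theorem aleph1_lt_kappa : ℵ_ 1 < kappa.{u} :=
  (cantor _).trans (Order.lt_succ _)

theorem aleph0_lt_kappa : ℵ₀ < kappa.{u} :=
  lt_of_le_of_lt (aleph0_le_aleph 1) aleph1_lt_kappa

theorem kappa_isRegular : kappa.{u}.IsRegular :=
  isRegular_succ ((aleph0_le_aleph 1).trans (cantor _).le)

theorem mem_omega1 {x : ZFSet.{u}} : x ∈ omega1 ↔ ∃ α < ω_ 1, α.toZFSet = x :=
  mem_toZFSet_iff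

theorem card_omega1 : omega1.{u}.card = ℵ_ 1 := by
  simp [omega1]

theorem omega1_mem_H : omega1.{u} ∈ H kappa :=
  toZFSet_mem_H (by simpa using aleph1_lt_kappa)

theorem mem_H_of_subset_omega1 {x : ZFSet.{u}} (h : x ⊆ omega1) : x ∈ H kappa :=
  mem_H_of_subset omega1_mem_H h

theorem mem_H_of_mem_omega1 {x : ZFSet.{u}} (h : x ∈ omega1) : x ∈ H kappa :=
  mem_H_of_mem omega1_mem_H h

theorem mem_H_of_subset_prod {R : ZFSet.{u}} (hR : R ⊆ prod omega1 omega1) : R ∈ H kappa := by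
  refine mem_H_of_card_lt kappa_isRegular ?_ ?_
  · intro z hz
    obtain ⟨a, ha, b, hb, rfl⟩ := mem_prod.1 (hR hz)
    exact pair_mem_H kappa_isRegular (mem_H_of_mem_omega1 ha) (mem_H_of_mem_omega1 hb)
  · refine ((card_mono hR).trans (card_prod_le _ _)).trans_lt ?_
    rw [card_omega1, mul_eq_self (aleph0_le_aleph 1)]
    exact aleph1_lt_kappa

theorem treeOn_mem_H {R : ZFSet.{u}} (hR : R ⊆ prod omega1 omega1) : treeOn R ∈ H kappa :=
  pair_mem_H kappa_isRegular omega1_mem_H (mem_H_of_subset_prod hR)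

theorem toZFSet_mem_H_of_lt {α : Ordinal.{u}} (h : α < ω_ 1) : α.toZFSet ∈ H kappa :=
  mem_H_of_mem_omega1 (mem_omega1.2 ⟨α, h, rfl⟩)

/-- Countably many countable ordinals have a countable strict upper bound. -/
theorem exists_countable_bound {s : Set Ordinal.{u}} (hs : s.Countable) (h : ∀ α ∈ s, α < ω_ 1) :
    ∃ β < ω_ 1, ∀ α ∈ s, α < β := by
  have := hs.to_subtype
  have hlim : Order.IsSuccLimit (ω_ 1 : Ordinal.{u}) := isSuccLimit_omega 1
  refine ⟨_, Ordinal.iSup_lt_omega_one (f := fun a : s => Order.succ a.1) fun a =>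
    hlim.succ_lt (h a a.2), fun α hα => ?_⟩
  exact (Order.lt_succ α).trans_le (Ordinal.le_iSup (fun a : s => Order.succ a.1) ⟨α, hα⟩)

theorem countable_Iio {α : Ordinal.{u}} (h : α < ω_ 1) : (Set.Iio α).Countable := by
  rw [← le_aleph0_iff_set_countable, Cardinal.mk_Iio_ordinal, lift_le_aleph0]
  have : α.card < ℵ_ 1 := by
    rw [← lt_ord, ord_aleph]; exact h
  rwa [← succ_aleph0, Order.lt_succ_iff] at this

/-! ### Closing under countably many functions, clubs -/

/-- Binary functions are general enough: constants and unary functions ignore arguments. Closing off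
takes `ω` steps. -/
theorem exists_countable_closed {α : Type*} {Φ : Set (α → α → α)} (hΦ : Φ.Countable) {U s : Set α}
    (hU : ∀ F ∈ Φ, ∀ x ∈ U, ∀ y ∈ U, F x y ∈ U) (hs : s.Countable) (hsU : s ⊆ U) :
    ∃ t, s ⊆ t ∧ t ⊆ U ∧ t.Countable ∧ ∀ F ∈ Φ, ∀ x ∈ t, ∀ y ∈ t, F x y ∈ t := by
  let step (a : Set α) : Set α := a ∪ ⋃ F ∈ Φ, Set.image2 F a a
  let t (n : ℕ) : Set α := step^[n] s
  have hsucc (n : ℕ) : t (n + 1) = step (t n) := Function.iterate_succ_apply' _ _ _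
  have hmono : Monotone t := monotone_nat_of_le_succ fun n => by
    rw [hsucc]; exact Set.subset_union_left
  refine ⟨⋃ n, t n, Set.subset_iUnion t 0, Set.iUnion_subset fun n => ?_,
    Set.countable_iUnion fun n => ?_, fun F hF x hx y hy => ?_⟩
  · induction n with
    | zero => exact hsU
    | succ n ih =>
      rw [hsucc]
      refine Set.union_subset ih (Set.iUnion₂_subset fun F hF => ?_)
      rintro _ ⟨x, hx, y, hy, rfl⟩
      exact hU F hF x (ih hx) y (ih hy)
  · induction n with
    | zero => exact hs
    | succ n ih =>
      rw [hsucc]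
      exact ih.union (hΦ.biUnion fun F _ => ih.image2 ih F)
  · rw [Set.mem_iUnion] at hx hy ⊢
    obtain ⟨m, hm⟩ := hx
    obtain ⟨n, hn⟩ := hy
    refine ⟨max m n + 1, ?_⟩
    rw [hsucc]
    exact Or.inr (Set.mem_biUnion hF (Set.mem_image2_of_mem (hmono (le_max_left m n) hm)
      (hmono (le_max_right m n) hn)))

theorem iUnion_mem_countableSubsets {X : Set ZFSet.{u}} {f : ℕ → ZFSet.{u}}
    (hf : ∀ n, f n ∈ countableSubsets X) : ZFSet.iUnion f ∈ countableSubsets X := by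
  simp only [countableSubsets, Set.mem_ofPred_eq, card_eq_aleph0_iff, coe_iUnion] at hf ⊢
  exact ⟨Set.iUnion_subset fun n => (hf n).1, Set.countable_iUnion fun n => (hf n).2.1,
    (hf 0).2.2.mono (Set.subset_iUnion (fun n => (f n : Set ZFSet)) 0)⟩

theorem isClubOf_closed {X : Set ZFSet.{u}} {Φ : Set (ZFSet.{u} → ZFSet.{u} → ZFSet.{u})}
    (hΦ : Φ.Countable) (hX : ∀ F ∈ Φ, ∀ x ∈ X, ∀ y ∈ X, F x y ∈ X) :
    IsClubOf X {a | a ∈ countableSubsets X ∧ ∀ F ∈ Φ, ∀ x ∈ a, ∀ y ∈ a, F x y ∈ a} where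
  subset _ h := h.1
  unbounded a ha := by
    obtain ⟨haX, hac⟩ := ha
    rw [card_eq_aleph0_iff] at hac
    obtain ⟨t, hat, htX, htc, ht⟩ := exists_countable_closed hΦ hX hac.1 haX
    obtain ⟨b, rfl, -⟩ := exists_of_countable htc
    exact ⟨b, ⟨⟨htX, card_eq_aleph0_iff.2 ⟨htc, hac.2.mono hat⟩⟩, ht⟩, hat⟩
  closed f hf hmono := by
    refine ⟨iUnion_mem_countableSubsets fun n => (hf n).1, fun F hF x hx y hy => ?_⟩
    rw [mem_iUnion] at hx hy ⊢
    obtain ⟨m, hm⟩ := hx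
    obtain ⟨n, hn⟩ := hy
    have hmono' : Monotone f := monotone_nat_of_le_succ hmono
    exact ⟨max m n, (hf _).2 F hF x (hmono' (le_max_left m n) hm) y
      (hmono' (le_max_right m n) hn)⟩

theorem countableSubsets_nonempty {X : Set ZFSet.{u}} (hX : X.Infinite) :
    (countableSubsets X).Nonempty := by
  let e := hX.natEmbedding X
  have hc : (Set.range fun n => (e n : ZFSet)).Countable := Set.countable_range _
  obtain ⟨a, ha, -⟩ := exists_of_countable hc
  refine ⟨a, ?_, card_eq_aleph0_iff.2 ⟨ha ▸ hc, ha ▸ Set.infinite_range_of_injective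
    (Subtype.val_injective.comp e.injective)⟩⟩
  rw [ha]
  rintro _ ⟨n, rfl⟩
  exact (e n).2

/-- Two clubs meet: an increasing sequence that alternates between `S` and `C` has the same union
along either half, and the union lies in both. -/
theorem IsClubOf.isStationaryOf {X S : Set ZFSet.{u}} (hX : X.Infinite) (hS : IsClubOf X S) :
    IsStationaryOf X S := by
  refine ⟨hS.subset, fun C hC => ?_⟩
  have key : ∀ a, ∃ b, a ∈ S → b ∈ S ∧ ∃ c ∈ C, a ⊆ c ∧ c ⊆ b := by
    intro a
    by_cases ha : a ∈ S
    · obtain ⟨c, hc, hac⟩ := hC.unbounded a (hS.subset ha)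
      obtain ⟨b, hb, hcb⟩ := hS.unbounded c (hC.subset hc)
      exact ⟨b, fun _ => ⟨hb, c, hc, hac, hcb⟩⟩
    · exact ⟨a, fun h => (ha h).elim⟩
  choose g hg using key
  obtain ⟨a₀, ha₀⟩ := countableSubsets_nonempty hX
  obtain ⟨a, ha, -⟩ := hS.unbounded a₀ ha₀
  let f (n : ℕ) : ZFSet := g^[n] a
  have hsucc (n : ℕ) : f (n + 1) = g (f n) := Function.iterate_succ_apply' _ _ _
  have hf (n : ℕ) : f n ∈ S := by
    induction n with
    | zero => exact ha
    | succ n ih => rw [hsucc]; exact (hg _ ih).1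
  choose c hcC hfc hcf using fun n => (hg _ (hf n)).2
  simp only [← hsucc] at hcf
  have hU : ZFSet.iUnion f = ZFSet.iUnion c := by
    ext z
    simp only [mem_iUnion]
    exact ⟨fun ⟨n, h⟩ => ⟨n, hfc n h⟩, fun ⟨n, h⟩ => ⟨n + 1, hcf n h⟩⟩
  refine ⟨ZFSet.iUnion f, hS.closed f hf fun n z hz => hcf n (hfc n hz), ?_⟩
  rw [hU]
  exact hC.closed c hcC fun n z hz => hfc (n + 1) (hcf n hz)

/-! ### Definable relations -/

section Def

variable {A : Set ZFSet.{u}} {n : ℕ}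

/-- The relation `P` is definable over `(A, ∈)` without parameters. -/
def Def (A : Set ZFSet.{u}) (n : ℕ) (P : (Fin n → ZFSet.{u}) → Prop) : Prop :=
  ∃ φ : setLanguage.BoundedFormula Empty n, ∀ v : Fin n → A,
    φ.Realize default v ↔ P (fun i => v i)

/-- The membership symbol. -/
def memSymbol : setLanguage.Relations 2 := SetRel.mem

theorem realize_mem (i j : Fin n) (v : Fin n → A) :
    (Language.Relations.boundedFormula₂ (α := Empty) (n := n) memSymbol
      (Language.Term.var (Sum.inr i)) (Language.Term.var (Sum.inr j))).Realize default v ↔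
        (v i : ZFSet) ∈ (v j : ZFSet) := by
  rw [Language.BoundedFormula.realize_rel₂]
  rfl

theorem Def.mem (i j : Fin n) : Def A n (fun v => v i ∈ v j) :=
  ⟨_, realize_mem i j⟩

theorem Def.eq (i j : Fin n) : Def A n (fun v => v i = v j) :=
  ⟨Language.Term.bdEqual (Language.Term.var (Sum.inr i)) (Language.Term.var (Sum.inr j)),
    fun v => by simp [Subtype.ext_iff]⟩

theorem Def.imp {P Q : (Fin n → ZFSet.{u}) → Prop} (hP : Def A n P) (hQ : Def A n Q) :
    Def A n (fun v => P v → Q v) := by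
  obtain ⟨φ, hφ⟩ := hP
  obtain ⟨ψ, hψ⟩ := hQ
  exact ⟨φ.imp ψ, fun v => by simp [hφ, hψ]⟩

theorem Def.and {P Q : (Fin n → ZFSet.{u}) → Prop} (hP : Def A n P) (hQ : Def A n Q) :
    Def A n (fun v => P v ∧ Q v) := by
  obtain ⟨φ, hφ⟩ := hP
  obtain ⟨ψ, hψ⟩ := hQ
  exact ⟨φ ⊓ ψ, fun v => by simp [hφ, hψ]⟩

theorem Def.or {P Q : (Fin n → ZFSet.{u}) → Prop} (hP : Def A n P) (hQ : Def A n Q) :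
    Def A n (fun v => P v ∨ Q v) := by
  obtain ⟨φ, hφ⟩ := hP
  obtain ⟨ψ, hψ⟩ := hQ
  exact ⟨φ ⊔ ψ, fun v => by simp [hφ, hψ]⟩

theorem Def.iff {P Q : (Fin n → ZFSet.{u}) → Prop} (hP : Def A n P) (hQ : Def A n Q) :
    Def A n (fun v => P v ↔ Q v) := by
  simpa only [iff_iff_implies_and_implies] using (hP.imp hQ).and (hQ.imp hP)

theorem Def.not {P : (Fin n → ZFSet.{u}) → Prop} (hP : Def A n P) : Def A n (fun v => ¬ P v) := by
  obtain ⟨φ, hφ⟩ := hP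
  exact ⟨φ.not, fun v => by simp [hφ]⟩

theorem Def.ex {P : ZFSet.{u} → (Fin n → ZFSet.{u}) → Prop}
    (hP : Def A (n + 1) (fun w => P (w (Fin.last n)) (fun i => w i.castSucc))) :
    Def A n (fun v => ∃ a ∈ A, P a v) := by
  obtain ⟨φ, hφ⟩ := hP
  exact ⟨φ.ex, fun v => by simp [hφ]⟩

variable (hA : ∀ x ∈ A, ∀ y ∈ x, y ∈ A)

include hA

/-- Transitivity of `A` is what makes a bounded quantifier over all sets agree with one over `A`. -/
theorem Def.bex {i : Fin n} {P : ZFSet.{u} → (Fin n → ZFSet.{u}) → Prop}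
    (hP : Def A (n + 1) (fun w => P (w (Fin.last n)) (fun i => w i.castSucc))) :
    Def A n (fun v => ∃ a ∈ v i, P a v) := by
  obtain ⟨φ, hφ⟩ := Def.ex (P := fun a v => a ∈ v i ∧ P a v)
    ((Def.mem (Fin.last n) i.castSucc).and hP)
  refine ⟨φ, fun v => (hφ v).trans ⟨fun ⟨a, _, h⟩ => ⟨a, h⟩, fun ⟨a, h⟩ => ⟨a, hA _ (v i).2 _ h.1, h⟩⟩⟩

theorem Def.ball {i : Fin n} {P : ZFSet.{u} → (Fin n → ZFSet.{u}) → Prop}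
    (hP : Def A (n + 1) (fun w => P (w (Fin.last n)) (fun i => w i.castSucc))) :
    Def A n (fun v => ∀ a ∈ v i, P a v) := by
  simpa using (Def.bex (i := i) (P := fun a v => ¬ P a v) hA hP.not).not

theorem Def.isEmpty (i : Fin n) : Def A n (fun v => v i = ∅) := by
  have h : Def A n (fun v => ∀ a ∈ v i, ¬ v i = v i) :=
    Def.ball hA (Def.eq _ _).not
  simpa [ZFSet.eq_empty] using h

theorem Def.isInsert (i j k : Fin n) : Def A n (fun v => v i = insert (v j) (v k)) := by
  have h : Def A n (fun v => v j ∈ v i ∧ (∀ a ∈ v k, a ∈ v i) ∧ ∀ a ∈ v i, a = v j ∨ a ∈ v k) :=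
    (Def.mem _ _).and ((Def.ball hA (Def.mem _ _)).and
      (Def.ball hA ((Def.eq _ _).or (Def.mem _ _))))
  convert h using 2 with v
  constructor
  · intro e
    simp_all
  · rintro ⟨h1, h2, h3⟩
    ext z
    rw [mem_insert_iff]
    exact ⟨h3 z, by rintro (rfl | h); exacts [h1, h2 z h]⟩

theorem Def.isUpair (i j k : Fin n) : Def A n (fun v => v i = {v j, v k}) := by
  have h : Def A n (fun v => v j ∈ v i ∧ v k ∈ v i ∧ ∀ a ∈ v i, a = v j ∨ a = v k) :=
    (Def.mem _ _).and ((Def.mem _ _).and (Def.ball hA ((Def.eq _ _).or (Def.eq _ _))))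
  convert h using 2 with v
  constructor
  · intro e
    simp_all
  · rintro ⟨h1, h2, h3⟩
    ext z
    rw [mem_pair]
    exact ⟨h3 z, by rintro (rfl | rfl) <;> assumption⟩

theorem Def.isPair (i j k : Fin n) : Def A n (fun v => v i = pair (v j) (v k)) := by
  have h : Def A n (fun v => (∃ a ∈ v i, a = {v j, v j}) ∧ (∃ a ∈ v i, a = {v j, v k}) ∧
      ∀ a ∈ v i, a = {v j, v j} ∨ a = {v j, v k}) :=
    (Def.bex hA (Def.isUpair hA _ _ _)).and ((Def.bex hA (Def.isUpair hA _ _ _)).and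
      (Def.ball hA ((Def.isUpair hA _ _ _).or (Def.isUpair hA _ _ _))))
  convert h using 2 with v
  simp only [pair_eq_singleton, pair, exists_eq_right]
  constructor
  · intro e
    simp_all
  · rintro ⟨h1, h2, h3⟩
    ext z
    rw [mem_pair]
    exact ⟨h3 z, by rintro (rfl | rfl) <;> assumption⟩

theorem Def.pair_mem (i j k : Fin n) : Def A n (fun v => pair (v j) (v k) ∈ v i) := by
  have h : Def A n (fun v => ∃ a ∈ v i, a = pair (v j) (v k)) := Def.bex hA (Def.isPair hA _ _ _)
  simpa using h

/-- The inner pair need not be an element of any variable, but it is an element of an element of the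
outer pair, so bounded quantifiers still reach it. -/
theorem Def.pair_pair_mem (i j k l : Fin n) :
    Def A n (fun v => pair (v j) (pair (v k) (v l)) ∈ v i) := by
  have h : Def A n (fun v => ∃ a ∈ v i, ∃ t ∈ a, ∃ q ∈ t,
      q = pair (v k) (v l) ∧ a = pair (v j) q) :=
    Def.bex hA (Def.bex hA (Def.bex hA ((Def.isPair hA _ _ _).and (Def.isPair hA _ _ _))))
  convert h using 2 with v
  constructor
  · exact fun h => ⟨_, h, {v j, pair (v k) (v l)}, by simp [pair], _, by simp, rfl, rfl⟩
  · rintro ⟨a, ha, t, -, q, -, rfl, rfl⟩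
    exact ha

end Def

/-! ### Elementary submodels -/

section Elementary

variable {A : Set ZFSet.{u}} {n : ℕ} (S : setLanguage.ElementarySubstructure A)

theorem exists_mem_of_def {P : ZFSet.{u} → (Fin n → ZFSet.{u}) → Prop}
    (hP : Def A (n + 1) (fun w => P (w (Fin.last n)) (fun i => w i.castSucc)))
    {v : Fin n → ZFSet.{u}} (hv : ∀ i, v i ∈ Subtype.val '' (S : Set A))
    (h : ∃ a ∈ A, P a v) : ∃ a ∈ Subtype.val '' (S : Set A), P a v := by
  obtain ⟨φ, hφ⟩ := hP
  choose w hw hwv using hv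
  let x : Fin n → S := fun i => ⟨w i, hw i⟩
  have key (y : A) : φ.Realize default (Fin.snoc (S.subtype ∘ x) y) ↔ P y v := by
    rw [hφ]
    simp [x, hwv]
  have hS : φ.ex.Realize (S.subtype ∘ default) (S.subtype ∘ x) := by
    obtain ⟨a, ha, h⟩ := h
    rw [Language.BoundedFormula.realize_ex]
    exact ⟨⟨a, ha⟩, by rw [Subsingleton.elim (S.subtype ∘ default) default]; exact (key ⟨a, ha⟩).2 h⟩
  rw [Language.ElementaryEmbedding.map_boundedFormula, Language.BoundedFormula.realize_ex] at hS
  obtain ⟨b, hb⟩ := hS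
  rw [← Language.ElementaryEmbedding.map_boundedFormula S.subtype, Fin.comp_snoc,
    Subsingleton.elim (S.subtype ∘ default) default] at hb
  exact ⟨_, ⟨_, b.2, rfl⟩, (key _).1 hb⟩

/-- A block of `k` witnesses is found one at a time: the last one is quantified away, the induction
hypothesis places the others in the submodel, and they then serve as parameters for the last. -/
theorem exists_append_of_def {k : ℕ} {P : (Fin (n + k) → ZFSet.{u}) → Prop}
    (hP : Def A (n + k) P) {v : Fin n → ZFSet.{u}} (hv : ∀ i, v i ∈ Subtype.val '' (S : Set A))
    (h : ∃ w : Fin k → ZFSet.{u}, (∀ i, w i ∈ A) ∧ P (Fin.append v w)) :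
    ∃ w : Fin k → ZFSet.{u}, (∀ i, w i ∈ Subtype.val '' (S : Set A)) ∧ P (Fin.append v w) := by
  induction k with
  | zero =>
    obtain ⟨w, -, hw⟩ := h
    exact ⟨w, fun i => i.elim0, hw⟩
  | succ k ih =>
    have hP' : Def A (n + k + 1) (fun w => P (Fin.snoc (fun i => w i.castSucc) (w (Fin.last _)))) := by
      have e : (fun w : Fin (n + k + 1) → ZFSet.{u} =>
          P (Fin.snoc (fun i => w i.castSucc) (w (Fin.last _)))) = P :=
        funext fun w => congrArg P (Fin.snoc_init_self w)
      rw [e]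
      exact hP
    obtain ⟨w, hw, hPw⟩ := h
    have hsnoc (w : Fin k → ZFSet.{u}) (a : ZFSet.{u}) :
        (Fin.snoc (Fin.append v w) a : Fin (n + k + 1) → ZFSet.{u}) =
          Fin.append v (Fin.snoc w a : Fin (k + 1) → ZFSet.{u}) := by
      exact (Fin.append_snoc v w a).symm
    obtain ⟨w', hw', h'⟩ := ih (Def.ex (P := fun a (v : Fin (n + k) → ZFSet.{u}) => P (Fin.snoc v a)) hP')
      ⟨fun i => w i.castSucc, fun i => hw _, w (Fin.last k), hw _, by
        rw [hsnoc]
        convert hPw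
        exact Fin.snoc_init_self w⟩
    obtain ⟨a, ha, h''⟩ := exists_mem_of_def (n := n + k) S
      (P := fun a (v : Fin (n + k) → ZFSet.{u}) => P (Fin.snoc v a)) hP'
      (v := Fin.append v w') (fun i => by
        refine Fin.addCases (fun i => ?_) (fun i => ?_) i
        · simpa using hv i
        · simpa using hw' i) h'
    refine ⟨Fin.snoc w' a, fun i => ?_, by rw [← hsnoc]; exact h''⟩
    refine Fin.lastCases ?_ (fun i => ?_) i
    · rw [Fin.snoc_last]; exact ha
    · rw [Fin.snoc_castSucc]; exact hw' i

end Elementary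

/-! ### Families of definable classes

A finite tuple of elements of `P` is coded by an iterated pair, and a first-order formula by the set
of the tuples that satisfy it. -/

/-- `D` is a family of subsets of `P` that contains the codes of the coordinate functions and is closed
under the operations that correspond to the formation of first-order formulas. -/
def IsDefFamily (P D : ZFSet.{u}) : Prop :=
  (∃ d ∈ D, ∀ a ∈ P, ∀ b ∈ P, ∀ e ∈ P, pair a (pair b e) ∈ d ↔ a = b) ∧
  (∀ d ∈ D, ∃ d' ∈ D, ∀ a ∈ P, ∀ b ∈ P, ∀ e ∈ P, pair a (pair b e) ∈ d' ↔ pair a e ∈ d) ∧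
  (∀ d ∈ D, ∀ d' ∈ D, ∃ d'' ∈ D, ∀ e ∈ P, e ∈ d'' ↔
    ∃ a ∈ P, ∃ b ∈ P, pair a e ∈ d ∧ pair b e ∈ d' ∧ a ∈ b) ∧
  (∀ d ∈ D, ∀ d' ∈ D, ∃ d'' ∈ D, ∀ e ∈ P, e ∈ d'' ↔
    ∃ a ∈ P, ∃ b ∈ P, pair a e ∈ d ∧ pair b e ∈ d' ∧ a = b) ∧
  (∃ d ∈ D, ∀ e ∈ P, ¬ e ∈ d) ∧
  (∀ d ∈ D, ∀ d' ∈ D, ∃ d'' ∈ D, ∀ e ∈ P, e ∈ d'' ↔ (e ∈ d → e ∈ d')) ∧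
  (∀ d ∈ D, ∃ d' ∈ D, ∀ e ∈ P, e ∈ d' ↔ ∀ a ∈ P, pair a e ∈ d)

/-- `M` contains the empty set, is closed under pairing and passes the Tarski-Vaught test in `P` for the
classes in `D`. -/
def IsTarskiVaught (P D M : ZFSet.{u}) : Prop :=
  (∃ e ∈ M, e = ∅) ∧ (∀ a ∈ M, ∀ b ∈ M, ∃ p ∈ M, p = pair a b) ∧
  ∀ d ∈ D, ∀ e ∈ M, (∃ a ∈ P, pair a e ∈ d) → ∃ a ∈ M, pair a e ∈ d

/-- The code of a finite tuple. -/
def code : (n : ℕ) → (Fin n → ZFSet.{u}) → ZFSet.{u}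
  | 0, _ => ∅
  | n + 1, x => pair (x (Fin.last n)) (code n fun i => x i.castSucc)

theorem code_mem {M : Set ZFSet.{u}} (h0 : ∅ ∈ M) (h2 : ∀ a ∈ M, ∀ b ∈ M, pair a b ∈ M) {n : ℕ}
    {x : Fin n → ZFSet.{u}} (hx : ∀ i, x i ∈ M) : code n x ∈ M := by
  induction n with
  | zero => exact h0
  | succ n ih => exact h2 _ (hx _) _ (ih fun i => hx _)

section

variable {θ : Cardinal.{u}} (hθ : θ.IsRegular) {D : ZFSet.{u}} (hD : IsDefFamily (hset θ) D)

include hθ in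
theorem code_mem_hset {n : ℕ} {x : Fin n → ZFSet.{u}} (hx : ∀ i, x i ∈ H θ) : code n x ∈ hset θ :=
  code_mem (M := (hset θ : Set ZFSet)) (by simpa using empty_mem_H hθ)
    (fun a ha b hb => by simpa using pair_mem_H hθ (mem_hset.1 ha) (mem_hset.1 hb))
    (by simpa using hx)

include hθ hD

theorem IsDefFamily.exists_coord {n : ℕ} (i : Fin n) : ∃ d ∈ D, ∀ a ∈ H θ,
    ∀ x : Fin n → ZFSet.{u}, (∀ i, x i ∈ H θ) → (pair a (code n x) ∈ d ↔ a = x i) := by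
  induction n with
  | zero => exact i.elim0
  | succ n ih =>
    refine Fin.lastCases ?_ (fun j => ?_) i
    · obtain ⟨d, hd, h⟩ := hD.1
      exact ⟨d, hd, fun a ha x hx => h a (mem_hset.2 ha) _ (mem_hset.2 (hx _)) _
        (code_mem_hset hθ fun i => hx _)⟩
    · obtain ⟨d, hd, h⟩ := ih j
      obtain ⟨d', hd', h'⟩ := hD.2.1 d hd
      exact ⟨d', hd', fun a ha x hx => (h' a (mem_hset.2 ha) _ (mem_hset.2 (hx _)) _
        (code_mem_hset hθ fun i => hx _)).trans (h a ha _ fun i => hx _)⟩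

/-- The language has no function symbols, so a term is a variable and is coded by the graph of a
coordinate function. -/
theorem IsDefFamily.exists_term {n : ℕ} (t : setLanguage.Term (Empty ⊕ Fin n)) : ∃ d ∈ D, ∀ a ∈ H θ,
    ∀ x : Fin n → H θ, (pair a (code n fun i => x i) ∈ d ↔
      a = (t.realize (Sum.elim default x) : H θ)) := by
  cases t with
  | var i =>
    cases i with
    | inl e => exact e.elim
    | inr i =>
      obtain ⟨d, hd, h⟩ := hD.exists_coord hθ i
      exact ⟨d, hd, fun a ha x => h a ha _ fun i => (x i).2⟩
  | func f => exact f.elim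

/-- Each clause of `IsDefFamily` is one case of the induction on formulas. Any family with these
clauses will do, which matters because reflection need not return the original one. -/
theorem IsDefFamily.exists_formula {n : ℕ} (φ : setLanguage.BoundedFormula Empty n) : ∃ d ∈ D,
    ∀ x : Fin n → H θ, code n (fun i => x i) ∈ d ↔ φ.Realize default x := by
  have hc {n : ℕ} (x : Fin n → H θ) : code n (fun i => x i) ∈ hset θ :=
    code_mem_hset hθ fun i => (x i).2
  induction φ with
  | falsum =>
    obtain ⟨d, hd, h⟩ := hD.2.2.2.2.1
    exact ⟨d, hd, fun x => iff_of_false (h _ (hc x)) id⟩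
  | equal t₁ t₂ =>
    obtain ⟨d₁, hd₁, h₁⟩ := hD.exists_term hθ t₁
    obtain ⟨d₂, hd₂, h₂⟩ := hD.exists_term hθ t₂
    obtain ⟨d, hd, h⟩ := hD.2.2.2.1 d₁ hd₁ d₂ hd₂
    refine ⟨d, hd, fun x => (h _ (hc x)).trans ?_⟩
    rw [Language.BoundedFormula.Realize]
    constructor
    · rintro ⟨a, ha, b, hb, h1, h2, rfl⟩
      rw [h₁ a (mem_hset.1 ha)] at h1
      rw [h₂ a (mem_hset.1 hb)] at h2
      exact Subtype.ext (h1.symm.trans h2)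
    · intro e
      exact ⟨_, mem_hset.2 (Subtype.prop _), _, mem_hset.2 (Subtype.prop _),
        (h₁ _ (Subtype.prop _) x).2 rfl, (h₂ _ (Subtype.prop _) x).2 rfl, congrArg _ e⟩
  | rel r ts =>
    cases r
    obtain ⟨d₁, hd₁, h₁⟩ := hD.exists_term hθ (ts 0)
    obtain ⟨d₂, hd₂, h₂⟩ := hD.exists_term hθ (ts 1)
    obtain ⟨d, hd, h⟩ := hD.2.2.1 d₁ hd₁ d₂ hd₂
    refine ⟨d, hd, fun x => (h _ (hc x)).trans ?_⟩
    constructor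
    · rintro ⟨a, ha, b, hb, h1, h2, hab⟩
      rw [h₁ a (mem_hset.1 ha)] at h1
      rw [h₂ b (mem_hset.1 hb)] at h2
      subst h1 h2
      exact hab
    · intro e
      exact ⟨_, mem_hset.2 (Subtype.prop _), _, mem_hset.2 (Subtype.prop _),
        (h₁ _ (Subtype.prop _) x).2 rfl, (h₂ _ (Subtype.prop _) x).2 rfl, e⟩
  | imp φ ψ ih₁ ih₂ =>
    obtain ⟨d₁, hd₁, h₁⟩ := ih₁
    obtain ⟨d₂, hd₂, h₂⟩ := ih₂
    obtain ⟨d, hd, h⟩ := hD.2.2.2.2.2.1 d₁ hd₁ d₂ hd₂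
    exact ⟨d, hd, fun x => by rw [h _ (hc x), h₁, h₂]; rfl⟩
  | @all n φ ih =>
    obtain ⟨d₁, hd₁, h₁⟩ := ih
    obtain ⟨d, hd, h⟩ := hD.2.2.2.2.2.2 d₁ hd₁
    refine ⟨d, hd, fun x => ?_⟩
    rw [h _ (hc x), Language.BoundedFormula.realize_all]
    have key (a : H θ) : pair a (code n fun i => x i) ∈ d₁ ↔ φ.Realize default (Fin.snoc x a) := by
      rw [← h₁]
      simp [code]
    exact ⟨fun h a => (key a).1 (h a (mem_hset.2 a.2)),
      fun h a ha => (key ⟨a, mem_hset.1 ha⟩).2 (h _)⟩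

theorem IsTarskiVaught.isCountableModel {M : ZFSet.{u}} (hM : IsTarskiVaught (hset θ) D M)
    (hMH : (M : Set ZFSet) ⊆ H θ) (hc : M.card ≤ ℵ₀) : IsCountableModel θ M := by
  obtain ⟨⟨_, h0, rfl⟩, h2, htv⟩ := hM
  replace h2 : ∀ a ∈ M, ∀ b ∈ M, pair a b ∈ M := by simpa using h2
  let S : setLanguage.Substructure (H θ) := ⟨{x | x.1 ∈ M}, fun f => f.elim⟩
  refine ⟨hc, S.toElementarySubstructure ?_, ?_⟩
  · intro n φ x a hφ
    obtain ⟨d, hd, h⟩ := hD.exists_formula hθ φ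
    have key (b : H θ) : pair b (code n fun i => (x i : H θ)) ∈ d ↔
        φ.Realize default (Fin.snoc ((↑) ∘ x) b : _ → H θ) := by
      rw [← h]
      simp [code]
    obtain ⟨b, hb, hbd⟩ := htv d hd (code n fun i => (x i : H θ))
      (code_mem (M := (M : Set ZFSet)) h0 h2 fun i => (x i).2) ⟨a, mem_hset.2 a.2, (key a).2 hφ⟩
    exact ⟨⟨⟨b, hMH hb⟩, hb⟩, (key ⟨b, hMH hb⟩).1 hbd⟩
  · ext z
    exact ⟨by rintro ⟨y, hy, rfl⟩; exact hy, fun hz => ⟨⟨z, hMH hz⟩, hz, rfl⟩⟩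

end

/-- There is a countable family of definable classes. -/
theorem exists_isDefFamily {θ : Cardinal.{u}} (hθ : θ.IsRegular) : ∃ D : ZFSet.{u}, (D : Set ZFSet).Countable ∧
    (∀ d ∈ D, d ⊆ hset θ) ∧ IsDefFamily (hset θ) D := by
  have hp {a b : ZFSet.{u}} (ha : a ∈ hset θ) (hb : b ∈ hset θ) : pair a b ∈ hset θ :=
    mem_hset.2 (pair_mem_H hθ (mem_hset.1 ha) (mem_hset.1 hb))
  let P : ZFSet.{u} := hset θ
  let z : ZFSet.{u} := P.sep fun x => ∃ a e, x = pair a (pair a e)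
  let F₁ : ZFSet.{u} → ZFSet.{u} → ZFSet.{u} := fun d _ => P.sep fun x =>
    ∃ a b e, x = pair a (pair b e) ∧ pair a e ∈ d
  let F₂ : ZFSet.{u} → ZFSet.{u} → ZFSet.{u} := fun d d' => P.sep fun e =>
    ∃ a ∈ P, ∃ b ∈ P, pair a e ∈ d ∧ pair b e ∈ d' ∧ a ∈ b
  let F₃ : ZFSet.{u} → ZFSet.{u} → ZFSet.{u} := fun d d' => P.sep fun e =>
    ∃ a ∈ P, ∃ b ∈ P, pair a e ∈ d ∧ pair b e ∈ d' ∧ a = b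
  let F₄ : ZFSet.{u} → ZFSet.{u} → ZFSet.{u} := fun d d' => P.sep fun e => e ∈ d → e ∈ d'
  let F₅ : ZFSet.{u} → ZFSet.{u} → ZFSet.{u} := fun d _ => P.sep fun e => ∀ a ∈ P, pair a e ∈ d
  obtain ⟨t, hst, htU, htc, ht⟩ := exists_countable_closed (Φ := {F₁, F₂, F₃, F₄, F₅})
    (U := {d | d ⊆ P}) (s := {z, ∅}) (by simp) (by
      rintro F (rfl | rfl | rfl | rfl | rfl) d - d' - <;> exact sep_subset) (by simp)
    (by rintro d (rfl | rfl); exacts [sep_subset, empty_subset _])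
  obtain ⟨D, rfl, -⟩ := exists_of_countable htc
  refine ⟨D, htc, htU, ⟨z, hst (by simp), ?_⟩, fun d hd => ⟨F₁ d d, ht _ (by simp) _ hd _ hd, ?_⟩,
    fun d hd d' hd' => ⟨F₂ d d', ht _ (by simp) _ hd _ hd', ?_⟩,
    fun d hd d' hd' => ⟨F₃ d d', ht _ (by simp) _ hd _ hd', ?_⟩, ⟨∅, hst (by simp), ?_⟩,
    fun d hd d' hd' => ⟨F₄ d d', ht _ (by simp) _ hd _ hd', ?_⟩,
    fun d hd => ⟨F₅ d d, ht _ (by simp) _ hd _ hd, ?_⟩⟩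
  · intro a ha b hb e he
    simp only [z, mem_sep, pair_inj]
    exact ⟨fun ⟨_, a', e', h1, h2, h3⟩ => h1.trans h2.symm,
      fun h => ⟨hp ha (hp hb he), a, e, rfl, h.symm, rfl⟩⟩
  · intro a ha b hb e he
    simp only [F₁, mem_sep, pair_inj]
    exact ⟨fun ⟨_, a', b', e', ⟨h1, h2, h3⟩, h⟩ => h1 ▸ h3 ▸ h,
      fun h => ⟨hp ha (hp hb he), a, b, e, ⟨rfl, rfl, rfl⟩, h⟩⟩
  · intro e he
    simp only [F₂, mem_sep, P, he, true_and]
  · intro e he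
    simp only [F₃, mem_sep, P, he, true_and]
  · intro e _
    exact notMem_empty e
  · intro e he
    simp only [F₄, mem_sep, P, he, true_and]
  · intro e he
    simp only [F₅, mem_sep, P, he, true_and]

/-! ### Heights in trees -/

section Tree

variable {X R x y z : ZFSet.{u}} {α β : Ordinal.{u}}

/-- The isomorphism `e` restricts to the predecessors of `y`, whose image is the initial segment
below `e y`. -/
theorem hasHeight_of_below (hT : IsTree X R) (hx : x ∈ X)
    (e : (fun y z : Preds X R x => Below R y.1 z.1) ≃r (fun β γ : Set.Iio α => β.1 < γ.1))
    (y : Preds X R x) : HasHeight X R y (e y) := by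
  have hlt (w : Preds X R y.1) : Below R w.1 x :=
    hT.trans _ w.2.1 _ y.2.1 _ hx w.2.2 y.2.2
  have hm (γ : Set.Iio (e y).1) : γ.1 ∈ Set.Iio α :=
    Set.mem_Iio.2 (lt_trans (Set.mem_Iio.1 γ.2) (Set.mem_Iio.1 (e y).2))
  have hsymm (γ : Set.Iio (e y).1) : Below R (e.symm ⟨γ.1, hm γ⟩).1 y := by
    have := e.symm.map_rel_iff.2 (show (⟨γ.1, hm γ⟩ : Set.Iio α).1 < (e y).1 from γ.2)
    simpa using this
  exact ⟨
    { toFun := fun w => ⟨e ⟨w.1, w.2.1, hlt w⟩, e.map_rel_iff.2 w.2.2⟩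
      invFun := fun γ => ⟨(e.symm ⟨γ.1, hm γ⟩).1, (e.symm _).2.1, hsymm γ⟩
      left_inv := fun w => by simp
      right_inv := fun γ => by simp
      map_rel_iff' := fun {a b} => e.map_rel_iff }⟩

theorem HasHeight.exists_lt (hT : IsTree X R) (hx : x ∈ X) (h : HasHeight X R x α) (hy : y ∈ X)
    (hyx : Below R y x) : ∃ β < α, HasHeight X R y β := by
  obtain ⟨e⟩ := h
  exact ⟨_, (e ⟨y, hy, hyx⟩).2, hasHeight_of_below hT hx e ⟨y, hy, hyx⟩⟩

theorem HasHeight.exists_below (hT : IsTree X R) (hx : x ∈ X) (h : HasHeight X R x α) (hβ : β < α) :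
    ∃ y ∈ X, Below R y x ∧ HasHeight X R y β := by
  obtain ⟨e⟩ := h
  refine ⟨_, (e.symm ⟨β, hβ⟩).2.1, (e.symm ⟨β, hβ⟩).2.2, ?_⟩
  simpa using hasHeight_of_below hT hx e (e.symm ⟨β, hβ⟩)

theorem HasHeight.unique (hT : IsTree X R) (hx : x ∈ X) (h : HasHeight X R x α)
    (h' : HasHeight X R x β) : α = β := by
  induction α using WellFoundedLT.induction generalizing x β with
  | ind α ih =>
    rcases lt_trichotomy α β with hlt | rfl | hlt
    -- The node of height `α` below `x` also has some height `γ < α`, against the induction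
    -- hypothesis at `γ`.
    · obtain ⟨y, hy, hyx, hyα⟩ := h'.exists_below hT hx hlt
      obtain ⟨γ, hγ, hyγ⟩ := h.exists_lt hT hx hy hyx
      exact absurd (ih γ hγ hy hyγ hyα) hγ.ne
    · rfl
    · obtain ⟨y, hy, hyx, hyβ⟩ := h.exists_below hT hx hlt
      obtain ⟨γ, hγ, hyγ⟩ := h'.exists_lt hT hx hy hyx
      exact absurd (ih γ (hγ.trans hlt) hy hyγ hyβ) hγ.ne

theorem HasHeight.lt_of_below (hT : IsTree X R) (hx : x ∈ X) (h : HasHeight X R x α) (hy : y ∈ X)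
    (hyx : Below R y x) (h' : HasHeight X R y β) : β < α := by
  obtain ⟨γ, hγ, hyγ⟩ := h.exists_lt hT hx hy hyx
  rwa [h'.unique hT hy hyγ]

theorem IsTree.comparable (hT : IsTree X R) (hx : x ∈ X) (hy : y ∈ X) (hz : z ∈ X)
    (hyx : y = x ∨ Below R y x) (hzx : z = x ∨ Below R z x) : y = z ∨ Below R y z ∨ Below R z y := by
  rcases hyx with rfl | hyx
  · rcases hzx with rfl | hzx
    · exact Or.inl rfl
    · exact Or.inr (Or.inr hzx)
  · rcases hzx with rfl | hzx
    · exact Or.inr (Or.inl hyx)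
    · have := hT.wellOrdered x hx
      rcases trichotomous_of (fun y z : Preds X R x => Below R y.1 z.1) ⟨y, hy, hyx⟩ ⟨z, hz, hzx⟩
        with h | h | h
      · exact Or.inr (Or.inl h)
      · exact Or.inl (congrArg Subtype.val h)
      · exact Or.inr (Or.inr h)

theorem IsTree.below_of_lt (hT : IsTree X R) (hx : x ∈ X) (hy : y ∈ X) (hz : z ∈ X)
    (hyx : y = x ∨ Below R y x) (hzx : z = x ∨ Below R z x) (hα : HasHeight X R y α)
    (hβ : HasHeight X R z β) (h : α < β) : Below R y z := by
  rcases hT.comparable hx hy hz hyx hzx with rfl | h' | h'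
  · exact absurd (hα.unique hT hy hβ) h.ne
  · exact h'
  · exact absurd (hα.lt_of_below hT hy hz h' hβ) h.not_gt

theorem IsTree.le_trans (hT : IsTree X R) (hx : x ∈ X) (hy : y ∈ X) (hz : z ∈ X)
    (hxy : x = y ∨ Below R x y) (hyz : y = z ∨ Below R y z) : x = z ∨ Below R x z := by
  rcases hxy with rfl | hxy
  · exact hyz
  · rcases hyz with rfl | hyz
    · exact Or.inr hxy
    · exact Or.inr (hT.trans x hx y hy z hz hxy hyz)

/-- The predecessors of `x` in a downward closed subset of `X` are its predecessors in `X`. -/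
def predsIso {A : ZFSet.{u}} (hAX : A ⊆ X) (hA : ∀ x ∈ A, ∀ y ∈ X, Below R y x → y ∈ A) (hx : x ∈ A) :
    (fun y z : Preds A R x => Below R y.1 z.1) ≃r (fun y z : Preds X R x => Below R y.1 z.1) where
  toEquiv := Equiv.subtypeEquivRight fun y =>
    ⟨fun h => ⟨hAX h.1, h.2⟩, fun h => ⟨hA x hx y h.1 h.2, h.2⟩⟩
  map_rel_iff' := Iff.rfl

theorem hasHeight_iff_of_subset {A : ZFSet.{u}} (hAX : A ⊆ X)
    (hA : ∀ x ∈ A, ∀ y ∈ X, Below R y x → y ∈ A) (hx : x ∈ A) :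
    HasHeight A R x α ↔ HasHeight X R x α :=
  ⟨fun ⟨e⟩ => ⟨(predsIso hAX hA hx).symm.trans e⟩, fun ⟨e⟩ => ⟨(predsIso hAX hA hx).trans e⟩⟩

theorem IsTree.subtree {A : ZFSet.{u}} (hT : IsTree X R) (hAX : A ⊆ X)
    (hA : ∀ x ∈ A, ∀ y ∈ X, Below R y x → y ∈ A) : IsTree A R where
  irrefl x hx := hT.irrefl x (hAX hx)
  trans x hx y hy z hz := hT.trans x (hAX hx) y (hAX hy) z (hAX hz)
  wellOrdered x hx :=
    have := hT.wellOrdered x (hAX hx)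
    (predsIso hAX hA hx).toRelEmbedding.isWellOrder

theorem IsOmegaOneTree.isAronszajnSubtree {A : ZFSet.{u}} (hT : IsOmegaOneTree X R) (hAX : A ⊆ X)
    (hA : ∀ x ∈ A, ∀ y ∈ X, Below R y x → y ∈ A)
    (hlev : ∀ α < ω_ 1, ∃ x ∈ A, HasHeight X R x α)
    (hch : ∀ c ⊆ A, IsTreeChain X R c → c.card ≤ ℵ₀) : IsAronszajnSubtree X R A := by
  refine ⟨hAX, hA, ⟨hT.isTree.subtree hAX hA, fun x hx => ?_, fun α hα => ?_, fun α hα => ?_⟩,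
    fun c hc => hch c hc.1 ⟨fun _ h => hAX (hc.1 h), hc.2⟩⟩
  · simpa only [hasHeight_iff_of_subset hAX hA hx] using hT.exists_height x (hAX hx)
  · obtain ⟨x, hx, h⟩ := hlev α hα
    exact ⟨x, hx, (hasHeight_iff_of_subset hAX hA hx).2 h⟩
  · refine (hT.level_countable α hα).mono fun x hx => ?_
    exact ⟨hAX hx.1, (hasHeight_iff_of_subset hAX hA hx.1).1 hx.2⟩

theorem IsOmegaOneTree.countable_height_lt (hT : IsOmegaOneTree X R) (hα : α < ω_ 1) :
    {x | x ∈ X ∧ ∃ β < α, HasHeight X R x β}.Countable :=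
  ((countable_Iio hα).biUnion fun β hβ => hT.level_countable β (lt_trans hβ hα)).mono
    fun x hx => by
      obtain ⟨hx, β, hβ, h⟩ := hx
      exact Set.mem_biUnion hβ ⟨hx, h⟩

theorem IsOmegaOneTree.exists_height_ge (hT : IsOmegaOneTree X R) (hα : α < ω_ 1) {c : ZFSet.{u}}
    (hcX : c ⊆ X) (hc : ¬ c.card ≤ ℵ₀) : ∃ x ∈ c, ∃ β, α ≤ β ∧ β < ω_ 1 ∧ HasHeight X R x β := by
  by_contra! h
  refine hc (card_le_aleph0_iff.2 ((hT.countable_height_lt hα).mono fun x hx => ?_))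
  obtain ⟨β, hβ, hxβ⟩ := hT.exists_height x (hcX hx)
  refine ⟨hcX hx, β, ?_, hxβ⟩
  by_contra! hαβ
  exact h x hx β hαβ hβ hxβ

end Tree

/-! ### Reflecting a sentence into a submodel -/

section Reflect

variable {A : Set ZFSet.{u}} {n : ℕ} (hA : ∀ x ∈ A, ∀ y ∈ x, y ∈ A)

include hA

theorem Def.isDefFamily (i j : Fin n) : Def A n (fun v => IsDefFamily (v i) (v j)) := by
  unfold IsDefFamily
  repeat' first
    | with_reducible exact Def.eq _ _
    | with_reducible exact Def.mem _ _
    | with_reducible exact Def.pair_mem hA _ _ _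
    | with_reducible exact Def.pair_pair_mem hA _ _ _ _
    | with_reducible refine Def.ball hA ?_
    | with_reducible refine Def.bex hA ?_
    | with_reducible refine Def.and ?_ ?_
    | with_reducible refine Def.iff ?_ ?_
    | with_reducible refine Def.not ?_
    | with_reducible refine Def.imp ?_ ?_

theorem Def.isTarskiVaught (i j k : Fin n) :
    Def A n (fun v => IsTarskiVaught (v i) (v j) (v k)) := by
  unfold IsTarskiVaught
  repeat' first
    | with_reducible exact Def.isEmpty hA _
    | with_reducible exact Def.isPair hA _ _ _
    | with_reducible exact Def.pair_mem hA _ _ _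
    | with_reducible refine Def.ball hA ?_
    | with_reducible refine Def.bex hA ?_
    | with_reducible refine Def.and ?_ ?_
    | with_reducible refine Def.imp ?_ ?_

end Reflect

/-- Every node of the tree `T = (O, R)` is captured by a member of the countable subset `f` of `S`, whose
members are elementary submodels of `P`. Here `f` is a sequence indexed by `w ⊆ ω`, the height
function of the tree is part of `h`, and `D` is a family of definable classes of `P`. -/
def CapturedByCountable (T S O R P w f D h : ZFSet.{u}) : Prop :=
  T = pair O R ∧
  (∀ y ∈ O, ∀ α ∈ O, (∀ z ∈ O, pair z y ∈ R → ∃ β ∈ α, pair z β ∈ h) →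
    (∀ β ∈ α, ∃ z ∈ O, pair z y ∈ R ∧ pair z β ∈ h) → pair y α ∈ h) ∧
  (∀ n ∈ w, n = ∅ ∨ ∃ m ∈ w, n = insert m m) ∧
  (∀ n ∈ w, ∀ M ∈ S, ∀ M' ∈ S, pair n M ∈ f → pair n M' ∈ f → M = M') ∧
  IsDefFamily P D ∧
  (∀ M ∈ S, ∀ a ∈ M, a ∈ P) ∧
  (∀ a ∈ P, ∃ M ∈ S, a ∈ M) ∧
  ∀ y ∈ O, ∃ n ∈ w, ∃ M ∈ S, pair n M ∈ f ∧ T ∈ M ∧ IsTarskiVaught P D M ∧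
    ∃ c ∈ M, (∀ z ∈ c, z ∈ O) ∧ (∀ y ∈ c, ∀ z ∈ c, y = z ∨ pair y z ∈ R ∨ pair z y ∈ R) ∧
      ∀ z ∈ O, (z = y ∨ pair z y ∈ R) → ∀ α ∈ M, pair z α ∈ h → z ∈ c

/-- The arity is split as `2 + 7`: `T` and `S` are parameters from `N`, the other seven sets are
witnesses that elementarity supplies. -/
theorem Def.capturedByCountable {A : Set ZFSet.{u}} (hA : ∀ x ∈ A, ∀ y ∈ x, y ∈ A) :
    Def A (2 + 7) (fun v => CapturedByCountable (v 0) (v 1) (v 2) (v 3) (v 4) (v 5) (v 6) (v 7)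
      (v 8)) := by
  unfold CapturedByCountable
  repeat' first
    | with_reducible exact Def.eq _ _
    | with_reducible exact Def.mem _ _
    | with_reducible exact Def.isEmpty hA _
    | with_reducible exact Def.isPair hA _ _ _
    | with_reducible exact Def.isInsert hA _ _ _
    | with_reducible exact Def.pair_mem hA _ _ _
    | with_reducible exact Def.isDefFamily hA _ _
    | with_reducible exact Def.isTarskiVaught hA _ _ _
    | with_reducible refine Def.ball hA ?_
    | with_reducible refine Def.bex hA ?_
    | with_reducible refine Def.and ?_ ?_
    | with_reducible refine Def.or ?_ ?_
    | with_reducible refine Def.imp ?_ ?_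

section Model

variable {θ : Cardinal.{u}} {N : ZFSet.{u}}

theorem exists_mem_model (S : setLanguage.ElementarySubstructure (H θ))
    (hS : Subtype.val '' (S : Set (H θ)) = (N : Set ZFSet.{u})) {n : ℕ}
    {P : ZFSet.{u} → (Fin n → ZFSet.{u}) → Prop}
    (hP : Def (H θ) (n + 1) (fun w => P (w (Fin.last n)) (fun i => w i.castSucc)))
    (v : Fin n → ZFSet.{u}) (hv : ∀ i, v i ∈ N) (h : ∃ a ∈ H θ, P a v) : ∃ a ∈ N, P a v := by
  have := exists_mem_of_def S hP (v := v) (by rw [hS]; exact hv) h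
  rwa [hS] at this

theorem IsCountableModel.subset_H (hN : IsCountableModel θ N) : (N : Set ZFSet) ⊆ H θ := by
  obtain ⟨-, S, hS⟩ := hN
  rw [← hS]
  rintro _ ⟨x, -, rfl⟩
  exact x.2

theorem IsCountableModel.empty_mem (hθ : θ.IsRegular) (hN : IsCountableModel θ N) : ∅ ∈ N := by
  obtain ⟨-, S, hS⟩ := hN
  obtain ⟨a, ha, rfl⟩ := exists_mem_model S hS (P := fun a (_ : Fin 0 → ZFSet) => a = ∅)
    (Def.isEmpty (fun _ hx _ => mem_H_of_mem hx) _) ![] (fun i => i.elim0)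
    ⟨∅, empty_mem_H hθ, rfl⟩
  exact ha

theorem IsCountableModel.insert_mem (hN : IsCountableModel θ N) {m : ZFSet.{u}} (hm : m ∈ N)
    (hmH : insert m m ∈ H θ) : insert m m ∈ N := by
  obtain ⟨-, S, hS⟩ := hN
  obtain ⟨a, ha, h⟩ := exists_mem_model S hS
    (P := fun a (v : Fin 1 → ZFSet) => a = insert (v 0) (v 0))
    (Def.isInsert (fun _ hx _ => mem_H_of_mem hx) _ _ _) ![m] (by simpa using hm)
    ⟨insert m m, hmH, rfl⟩
  exact h ▸ ha

theorem IsCountableModel.exists_pair_mem (hN : IsCountableModel θ N) {n S f M : ZFSet.{u}}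
    (hn : n ∈ N) (hS : S ∈ N) (hf : f ∈ N) (hM : M ∈ S) (h : pair n M ∈ f) :
    ∃ M' ∈ N, M' ∈ S ∧ pair n M' ∈ f := by
  have hMH : M ∈ H θ := mem_H_of_mem (hN.subset_H hS) hM
  obtain ⟨-, E, hE⟩ := hN
  have hA : ∀ x ∈ H θ, ∀ y ∈ x, y ∈ H θ := fun _ hx _ => mem_H_of_mem hx
  exact exists_mem_model E hE (P := fun a (v : Fin 3 → ZFSet) => a ∈ v 1 ∧ pair (v 0) a ∈ v 2)
    ((Def.mem _ _).and (Def.pair_mem hA _ _ _)) ![n, S, f]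
    (by intro i; fin_cases i <;> assumption) ⟨M, hMH, hM, h⟩

theorem insert_mem_H (hθ : θ.IsRegular) {m : ZFSet.{u}} (hm : m ∈ H θ) : insert m m ∈ H θ := by
  refine mem_H_of_card_lt hθ ?_ (card_insert_le.trans_lt
    (add_lt_of_lt hθ.aleph0_le (card_lt_of_mem_H hm) (one_lt_aleph0.trans_le hθ.aleph0_le)))
  intro z hz
  rcases mem_insert_iff.1 hz with rfl | hz
  · exact hm
  · exact mem_H_of_mem hm hz

/-- The set `w` is only known to consist of `∅` and successors of its own elements; by `∈`-induction
this already puts its elements into `N`. -/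
theorem IsCountableModel.mem_of_natural (hθ : θ.IsRegular) (hN : IsCountableModel θ N)
    {w : ZFSet.{u}} (hw : ∀ n ∈ w, n = ∅ ∨ ∃ m ∈ w, n = insert m m) (n : ZFSet.{u}) (hn : n ∈ w) :
    n ∈ N := by
  induction n using ZFSet.inductionOn with
  | h n ih =>
    rcases hw n hn with rfl | ⟨m, hm, rfl⟩
    · exact hN.empty_mem hθ
    · have := ih m (by simp) hm
      exact hN.insert_mem this (insert_mem_H hθ (hN.subset_H this))

theorem IsCountableModel.exists_capturedByCountable (hN : IsCountableModel θ N) {T S : ZFSet.{u}}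
    (hT : T ∈ N) (hS : S ∈ N)
    (h : ∃ O ∈ H θ, ∃ R ∈ H θ, ∃ P ∈ H θ, ∃ w ∈ H θ, ∃ f ∈ H θ, ∃ D ∈ H θ, ∃ h ∈ H θ,
      CapturedByCountable T S O R P w f D h) :
    ∃ O R P w D h, ∃ f ∈ N, CapturedByCountable T S O R P w f D h := by
  obtain ⟨-, E, hE⟩ := hN
  obtain ⟨O, hO, R, hR, P, hP, w, hw, f, hf, D, hD, h, hh, hc⟩ := h
  obtain ⟨x, hx, hc'⟩ := exists_append_of_def E
    (Def.capturedByCountable (A := H θ) fun _ hx _ => mem_H_of_mem hx) (v := ![T, S])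
    (by rw [hE]; intro i; fin_cases i <;> assumption)
    ⟨![O, R, P, w, f, D, h], by intro i; fin_cases i <;> assumption, hc⟩
  rw [hE] at hx
  exact ⟨x 0, x 1, x 2, x 3, x 5, x 6, x 4, hx 4, hc'⟩

end Model

/-! ### Trees without Aronszajn subtrees -/

/-- Some chain in `M` contains all `z ≤ y` with height in `M`. -/
def Captured (R M y : ZFSet.{u}) : Prop :=
  ∃ c ∈ M, IsTreeChain omega1 R c ∧ ∀ z ∈ omega1, (z = y ∨ Below R z y) →
    ∀ α < ω_ 1, HasHeight omega1 R z α → α.toZFSet ∈ M → z ∈ c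

/-- `M` contains `T = (ω₁, R)`, passes the Tarski-Vaught test for `D`, and contains the elements of each
of its countable elements. -/
def IsGood (R D M : ZFSet.{u}) : Prop :=
  treeOn R ∈ M ∧ IsTarskiVaught (hset kappa) D M ∧ ∀ a ∈ M, a.card ≤ ℵ₀ → a ⊆ M

theorem exists_enumeration (x : ZFSet.{u}) : ∃ g : ℕ → ZFSet.{u},
    (∀ n, g n ∈ x ∨ g n = ∅) ∧ (x.card ≤ ℵ₀ → ∀ z ∈ x, ∃ n, g n = z) := by
  by_cases h : x.card ≤ ℵ₀ ∧ x.Nonempty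
  · obtain ⟨g, hg⟩ := (card_le_aleph0_iff.1 h.1).exists_eq_range h.2
    have hg' (z) : z ∈ x ↔ ∃ n, g n = z := Set.ext_iff.1 hg z
    exact ⟨g, fun n => Or.inl ((hg' _).2 ⟨n, rfl⟩), fun _ z hz => (hg' z).1 hz⟩
  · exact ⟨fun _ => ∅, fun _ => Or.inr rfl, fun hx z hz => (h ⟨hx, z, hz⟩).elim⟩

/-- Goodness is closure under countably many functions: constants, pairing, a Skolem function for
each class in `D`, and the terms of a chosen enumeration of each countable set. The closed sets form
a club, which `S` meets. -/
theorem IsStationaryOf.exists_isGood {S : Set ZFSet.{u}} (hS : IsStationaryOf (H kappa) S)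
    {R D p : ZFSet.{u}} (hR : R ⊆ prod omega1 omega1) (hD : (D : Set ZFSet).Countable)
    (hp : p ∈ H kappa) : ∃ M ∈ S, p ∈ M ∧ IsGood R D M := by
  have hsk : ∀ d e : ZFSet.{u}, ∃ a ∈ H kappa, (∃ b ∈ hset kappa, pair b e ∈ d) → pair a e ∈ d := by
    intro d e
    by_cases h : ∃ b ∈ hset kappa, pair b e ∈ d
    · obtain ⟨b, hb, h⟩ := h
      exact ⟨b, mem_hset.1 hb, fun _ => h⟩
    · exact ⟨∅, empty_mem_H kappa_isRegular, fun h' => (h h').elim⟩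
  choose sk hskH hsk using hsk
  choose g hg hg' using exists_enumeration.{u}
  let Φ : Set (ZFSet.{u} → ZFSet.{u} → ZFSet.{u}) :=
    {fun _ _ => ∅, fun _ _ => p, fun _ _ => treeOn R, pair} ∪
      ((fun d e _ => sk d e) '' (D : Set ZFSet.{u}) ∪ Set.range fun n x _ => g x n)
  have hΦ : Φ.Countable :=
    (Set.to_countable _).union ((hD.image _).union (Set.countable_range _))
  have hΦH : ∀ F ∈ Φ, ∀ x ∈ H kappa, ∀ y ∈ H kappa, F x y ∈ H kappa := by
    rintro F ((rfl | rfl | rfl | rfl) | ⟨d, -, rfl⟩ | ⟨n, rfl⟩) x hx y hy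
    · exact empty_mem_H kappa_isRegular
    · exact hp
    · exact treeOn_mem_H hR
    · exact pair_mem_H kappa_isRegular hx hy
    · exact hskH _ _
    · rcases hg x n with h | h
      · exact mem_H_of_mem hx h
      · simp only [h]
        exact empty_mem_H kappa_isRegular
  obtain ⟨M, hMS, ⟨hMH, hMc⟩, hM⟩ := hS.2 _ (isClubOf_closed hΦ hΦH)
  obtain ⟨m, hm⟩ := (card_eq_aleph0_iff.1 hMc).2.nonempty
  have hconst {q : ZFSet.{u}} (hq : (fun _ _ => q) ∈ Φ) : q ∈ M := hM _ hq m hm m hm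
  refine ⟨M, hMS, hconst (by simp [Φ]), hconst (by simp [Φ]),
    ⟨⟨∅, hconst (by simp [Φ]), rfl⟩, fun a ha b hb => ⟨_, hM pair (by simp [Φ]) a ha b hb, rfl⟩,
      fun d hd e he h => ⟨sk d e, ?_, hsk d e h⟩⟩, fun a ha hac z hz => ?_⟩
  · exact hM _ (Or.inr (Or.inl ⟨d, hd, rfl⟩)) e he e he
  · obtain ⟨n, rfl⟩ := hg' a hac z hz
    exact hM _ (Or.inr (Or.inr ⟨n, rfl⟩)) a ha a ha

theorem IsGood.toZFSet_mem {R D M : ZFSet.{u}} (hM : IsGood R D M) {α β : Ordinal.{u}}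
    (hα : α < ω_ 1) (hαM : α.toZFSet ∈ M) (hβ : β ≤ α) : β.toZFSet ∈ M := by
  rcases hβ.eq_or_lt with rfl | hβ
  · exact hαM
  · refine hM.2.2 _ hαM ?_ (toZFSet_mem_toZFSet_iff.2 hβ)
    rw [card_toZFSet]
    have : α.card < ℵ_ 1 := by
      rw [← lt_ord, ord_aleph]; exact hα
    rwa [← succ_aleph0, Order.lt_succ_iff] at this

/-- Since `M ∩ ω₁` is an initial segment that omits the height of `y`, the nodes below `x` with
height in `M` are already below `y`. -/
theorem Captured.of_le {R D M x y : ZFSet.{u}} {α : Ordinal.{u}} (hT : IsTree omega1 R)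
    (hM : IsGood R D M) (h : Captured R M y) (hx : x ∈ omega1) (hy : y ∈ omega1)
    (hyx : y = x ∨ Below R y x) (hα : HasHeight omega1 R y α) (hαM : α.toZFSet ∉ M) :
    Captured R M x := by
  obtain ⟨c, hcM, hc, h⟩ := h
  refine ⟨c, hcM, hc, fun z hz hzx β hβ hzβ hβM => h z hz (Or.inr ?_) β hβ hzβ hβM⟩
  refine hT.below_of_lt hx hz hy hzx hyx hzβ hα ?_
  by_contra! hαβ
  exact hαM (hM.toZFSet_mem hβ hβM hαβ)

/-- The nodes that are not captured by any good `M` in `S` with `M ∩ ω₁` at most their height. -/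
noncomputable def uncaptured (R S D : ZFSet.{u}) : ZFSet.{u} :=
  omega1.sep fun y => ∀ M ∈ S, IsGood R D M → ∀ α < ω_ 1, HasHeight omega1 R y α →
    α.toZFSet ∉ M → ¬ Captured R M y

section

variable {R S D : ZFSet.{u}} (hR : R ⊆ prod omega1 omega1) (hT : IsOmegaOneTree omega1 R)
  (hS : IsStationaryOf (H kappa) S) (hD : (D : Set ZFSet).Countable)

include hR hT hS hD

theorem countable_of_chain_uncaptured {c : ZFSet.{u}} (hc : c ⊆ uncaptured R S D)
    (hch : IsTreeChain omega1 R c) : c.card ≤ ℵ₀ := by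
  by_contra hcc
  -- Capturing requires all predecessors, so `c` is replaced by its downward closure, which is again
  -- a chain.
  let b : ZFSet.{u} := omega1.sep fun y => ∃ z ∈ c, y = z ∨ Below R y z
  have hb : IsTreeChain omega1 R b := by
    refine ⟨sep_subset, fun y hy y' hy' => ?_⟩
    obtain ⟨hyX, z, hz, hyz⟩ := mem_sep.1 hy
    obtain ⟨hyX', z', hz', hyz'⟩ := mem_sep.1 hy'
    have hzX := hch.1 hz
    have hzX' := hch.1 hz'
    have key : (z = z' ∨ Below R z z') ∨ (z' = z ∨ Below R z' z) := by
      rcases hch.2 z hz z' hz' with h | h | h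
      · exact Or.inl (Or.inl h)
      · exact Or.inl (Or.inr h)
      · exact Or.inr (Or.inr h)
    rcases key with h | h
    · exact hT.isTree.comparable hzX' hyX hyX' (hT.isTree.le_trans hyX hzX hzX' hyz h) hyz'
    · exact hT.isTree.comparable hzX hyX hyX' hyz (hT.isTree.le_trans hyX' hzX' hzX hyz' h)
  obtain ⟨M, hMS, hbM, hM⟩ := hS.exists_isGood hR hD (mem_H_of_subset_omega1 hb.1)
  have hMc : (M : Set ZFSet).Countable := (card_eq_aleph0_iff.1 (hS.1 hMS).2).1
  obtain ⟨β, hβ, hβM⟩ := exists_countable_bound (s := {α | α < ω_ 1 ∧ α.toZFSet ∈ M})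
    ((hMc.preimage toZFSet_injective).mono fun _ h => h.2) fun _ h => h.1
  -- As `β` bounds `M ∩ ω₁`, the height of `z` is outside `M`, while `b ∈ M` captures `z`.
  obtain ⟨z, hz, γ, hβγ, hγ, hzγ⟩ := hT.exists_height_ge hβ hch.1 hcc
  refine (mem_sep.1 (hc hz)).2 M hMS hM γ hγ hzγ
    (fun hγM => (hβM γ ⟨hγ, hγM⟩).not_ge hβγ) ⟨b, hbM, hb, fun y hy hyz _ _ _ _ => ?_⟩
  exact mem_sep.2 ⟨hy, z, hz, hyz⟩

theorem isAronszajnSubtree_uncaptured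
    (hlev : ∀ α < ω_ 1, ∃ x ∈ uncaptured R S D, HasHeight omega1 R x α) :
    IsAronszajnSubtree omega1 R (uncaptured R S D) := by
  refine hT.isAronszajnSubtree sep_subset (fun x hx y hy hyx => ?_) hlev
    fun c hc hch => countable_of_chain_uncaptured hR hT hS hD hc hch
  obtain ⟨hxX, hx⟩ := mem_sep.1 hx
  refine mem_sep.2 ⟨hy, fun M hMS hM α hα hyα hαM h => ?_⟩
  obtain ⟨γ, hγ, hxγ⟩ := hT.exists_height x hxX
  have hαγ := hxγ.lt_of_below hT.isTree hxX hy hyx hyα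
  exact hx M hMS hM γ hγ hxγ (fun hγM => hαM (hM.toZFSet_mem hγ hγM hαγ.le))
    (h.of_le hT.isTree hM hxX hy (Or.inr hyx) hyα hαM)

/-- The nodes up to `y` form a chain, and stationarity gives a good `M` that has this chain as an
element. -/
theorem exists_captured {y : ZFSet.{u}} (hy : y ∈ omega1) : ∃ M ∈ S, IsGood R D M ∧ Captured R M y := by
  let c : ZFSet.{u} := omega1.sep fun z => z = y ∨ Below R z y
  have hc : c ⊆ omega1 := sep_subset
  obtain ⟨M, hMS, hcM, hM⟩ := hS.exists_isGood hR hD (mem_H_of_subset_omega1 hc)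
  exact ⟨M, hMS, hM, c, hcM, ⟨hc, fun z hz z' hz' => hT.isTree.comparable hy (hc hz) (hc hz')
    (mem_sep.1 hz).2 (mem_sep.1 hz').2⟩, fun z hz hzy _ _ _ _ => mem_sep.2 ⟨hz, hzy⟩⟩

/-- If a tree has no Aronszajn subtree, then countably many models capture all its nodes. -/
theorem exists_seq_captured (hA : ¬ ∃ A, IsAronszajnSubtree omega1 R A) :
    ∃ g : ℕ → ZFSet.{u}, (∀ n, g n ∈ S ∧ IsGood R D (g n)) ∧ ∀ y ∈ omega1, ∃ n, Captured R (g n) y := by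
  have hlev : ¬ ∀ α < ω_ 1, ∃ x ∈ uncaptured R S D, HasHeight omega1 R x α :=
    fun h => hA ⟨_, isAronszajnSubtree_uncaptured hR hT hS hD h⟩
  push Not at hlev
  obtain ⟨α, hα, hlev⟩ := hlev
  have hα' : Order.succ α < ω_ 1 := (isSuccLimit_omega 1).succ_lt hα
  -- These are the nodes of height at most `α`. Those of height exactly `α` get a model that omits
  -- `α`, so that it captures everything above them as well.
  let Z : Set ZFSet.{u} := {y | y ∈ omega1 ∧ ∃ β < Order.succ α, HasHeight omega1 R y β}
  have hZc : Z.Countable := hT.countable_height_lt hα'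
  have hM : ∀ y : ZFSet.{u}, ∃ M, y ∈ Z → M ∈ S ∧ IsGood R D M ∧ Captured R M y ∧
      (HasHeight omega1 R y α → α.toZFSet ∉ M) := by
    intro y
    by_cases hy : y ∈ omega1
    · by_cases hyα : HasHeight omega1 R y α
      · have h : y ∉ uncaptured R S D := fun h => hlev y h hyα
        simp only [uncaptured, mem_sep, hy, true_and] at h
        push Not at h
        obtain ⟨M, hMS, hM, β, hβ, hyβ, hβM, h⟩ := h
        obtain rfl := hyα.unique hT.isTree hy hyβ
        exact ⟨M, fun _ => ⟨hMS, hM, h, fun _ => hβM⟩⟩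
      · obtain ⟨M, hMS, hM, h⟩ := exists_captured hR hT hS hD hy
        exact ⟨M, fun _ => ⟨hMS, hM, h, fun h => (hyα h).elim⟩⟩
    · exact ⟨∅, fun h => (hy h.1).elim⟩
  choose M hM using hM
  have hZ : Z.Nonempty := by
    obtain ⟨y, hy, hyα⟩ := hT.level_nonempty α hα
    exact ⟨y, hy, α, Order.lt_succ α, hyα⟩
  obtain ⟨e, he⟩ := hZc.exists_eq_range hZ
  have heZ (n) : e n ∈ Z := he ▸ ⟨n, rfl⟩
  refine ⟨fun n => M (e n), fun n => ⟨(hM _ (heZ n)).1, (hM _ (heZ n)).2.1⟩, fun y hy => ?_⟩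
  obtain ⟨β, hβ, hyβ⟩ := hT.exists_height y hy
  rcases lt_or_ge β (Order.succ α) with hβα | hβα
  · have : y ∈ Z := ⟨hy, β, hβα, hyβ⟩
    rw [he] at this
    obtain ⟨n, rfl⟩ := this
    exact ⟨n, (hM _ (heZ n)).2.2.1⟩
  · obtain ⟨z, hz, hzy, hzα⟩ := hyβ.exists_below hT.isTree hy (Order.succ_le_iff.1 hβα)
    have hzZ : z ∈ Z := ⟨hz, α, Order.lt_succ α, hzα⟩
    have : z ∈ Set.range e := he ▸ hzZ
    obtain ⟨n, rfl⟩ := this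
    obtain ⟨-, hG, hC, hαM⟩ := hM _ hzZ
    exact ⟨n, hC.of_le hT.isTree hG hy hz (Or.inr hzy) hzα (hαM hzα)⟩

end

/-! ### Weakly external nodes yield Aronszajn subtrees -/

/-- The reflected `h` need not be the height function. It contains its graph, by induction on the
height, and that is enough: extra pairs only strengthen the capturing clause. -/
theorem pair_toZFSet_mem {R h : ZFSet.{u}} (hT : IsOmegaOneTree omega1 R)
    (hh : ∀ y ∈ omega1, ∀ α ∈ omega1, (∀ z ∈ omega1, pair z y ∈ R → ∃ β ∈ α, pair z β ∈ h) →
      (∀ β ∈ α, ∃ z ∈ omega1, pair z y ∈ R ∧ pair z β ∈ h) → pair y α ∈ h)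
    {α : Ordinal.{u}} (hα : α < ω_ 1) {y : ZFSet.{u}} (hy : y ∈ omega1)
    (hyα : HasHeight omega1 R y α) : pair y α.toZFSet ∈ h := by
  induction α using WellFoundedLT.induction generalizing y with
  | ind α ih =>
    refine hh y hy _ (mem_omega1.2 ⟨α, hα, rfl⟩) (fun z hz hzy => ?_) fun b hb => ?_
    · obtain ⟨β, hβ, hzβ⟩ := hyα.exists_lt hT.isTree hy hz hzy
      exact ⟨_, toZFSet_mem_toZFSet_iff.2 hβ, ih β hβ (hβ.trans hα) hz hzβ⟩
    · obtain ⟨β, hβ, rfl⟩ := mem_toZFSet_iff.1 hb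
      obtain ⟨z, hz, hzy, hzβ⟩ := hyα.exists_below hT.isTree hy hβ
      exact ⟨z, hz, hzy, ih β hβ (hβ.trans hα) hz hzβ⟩

/-- The graph of the height function. -/
noncomputable def heightGraph (R : ZFSet.{u}) : ZFSet.{u} :=
  (prod omega1 omega1).sep fun p => ∃ y α, p = pair y α.toZFSet ∧ HasHeight omega1 R y α

theorem pair_mem_heightGraph {R y : ZFSet.{u}} {α : Ordinal.{u}} :
    pair y α.toZFSet ∈ heightGraph R ↔ y ∈ omega1 ∧ α < ω_ 1 ∧ HasHeight omega1 R y α := by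
  simp only [heightGraph, mem_sep, pair_mem_prod, pair_inj, mem_omega1 (x := α.toZFSet)]
  constructor
  · rintro ⟨⟨hy, β, hβ, e⟩, z, γ, ⟨rfl, e'⟩, h⟩
    obtain rfl := toZFSet_injective e
    obtain rfl := toZFSet_injective e'
    exact ⟨hy, hβ, h⟩
  · rintro ⟨hy, hα, h⟩
    exact ⟨⟨hy, α, hα, rfl⟩, y, α, ⟨rfl, rfl⟩, h⟩

/-- The set of natural numbers. -/
noncomputable def naturals : ZFSet.{u} := range fun n : ℕ => (n : Ordinal.{u}).toZFSet

/-- The sequence `g` as a set. -/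
noncomputable def seqGraph (g : ℕ → ZFSet.{u}) : ZFSet.{u} :=
  range fun n : ℕ => pair (n : Ordinal.{u}).toZFSet (g n)

theorem pair_mem_seqGraph {g : ℕ → ZFSet.{u}} {n : ℕ} {M : ZFSet.{u}} :
    pair (n : Ordinal.{u}).toZFSet M ∈ seqGraph g ↔ g n = M := by
  simp only [seqGraph, mem_range, pair_inj]
  constructor
  · rintro ⟨m, e, rfl⟩
    obtain rfl : m = n := by simpa using toZFSet_injective e
    rfl
  · exact fun h => ⟨n, rfl, h⟩

theorem capturedByCountable_of_seq {R S D : ZFSet.{u}} (hT : IsOmegaOneTree omega1 R)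
    (hS : (S : Set ZFSet) ⊆ countableSubsets (H kappa)) (hSH : ∀ a ∈ H kappa, ∃ M ∈ S, a ∈ M)
    (hD : IsDefFamily (hset kappa) D) {g : ℕ → ZFSet.{u}} (hg : ∀ n, g n ∈ S ∧ IsGood R D (g n))
    (hgc : ∀ y ∈ omega1, ∃ n, Captured R (g n) y) :
    CapturedByCountable (treeOn R) S omega1 R (hset kappa) naturals (seqGraph g) D
      (heightGraph R) := by
  refine ⟨rfl, fun y hy a ha h1 h2 => ?_, fun n hn => ?_, fun n hn M _ M' _ h h' => ?_, hD,
    fun M hM a ha => mem_hset.2 ((hS hM).1 ha), fun a ha => hSH a (mem_hset.1 ha), fun y hy => ?_⟩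
  · obtain ⟨α, hα, rfl⟩ := mem_omega1.1 ha
    obtain ⟨γ, hγ, hyγ⟩ := hT.exists_height y hy
    suffices h : γ = α from pair_mem_heightGraph.2 ⟨hy, hα, h ▸ hyγ⟩
    -- If `γ < α`, then `h2` gives a node of height `γ` below `y`; if `α < γ`, then `h1` gives the
    -- node of height `α` below `y` a height less than `α`. Both are impossible.
    rcases lt_trichotomy γ α with h | h | h
    · obtain ⟨z, hz, hzy, hzγ⟩ := h2 _ (toZFSet_mem_toZFSet_iff.2 h)
      have := hyγ.lt_of_below hT.isTree hy hz hzy (pair_mem_heightGraph.1 hzγ).2.2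
      exact absurd this (lt_irrefl _)
    · exact h
    · obtain ⟨z, hz, hzy, hzα⟩ := hyγ.exists_below hT.isTree hy h
      obtain ⟨b, hb, hzb⟩ := h1 z hz hzy
      obtain ⟨β, hβ, rfl⟩ := mem_toZFSet_iff.1 hb
      exact absurd (hzα.unique hT.isTree hz (pair_mem_heightGraph.1 hzb).2.2) hβ.ne'
  · obtain ⟨n, rfl⟩ := mem_range.1 hn
    cases n with
    | zero => exact Or.inl (by simp)
    | succ n => exact Or.inr ⟨_, mem_range.2 ⟨n, rfl⟩, by rw [Nat.cast_succ, toZFSet_add_one]⟩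
  · obtain ⟨n, rfl⟩ := mem_range.1 hn
    exact (pair_mem_seqGraph.1 h).symm.trans (pair_mem_seqGraph.1 h')
  · obtain ⟨n, c, hc, hch, h⟩ := hgc y hy
    refine ⟨_, mem_range.2 ⟨n, rfl⟩, g n, (hg n).1, pair_mem_seqGraph.2 rfl, (hg n).2.1, (hg n).2.2.1, c,
      hc, fun z hz => hch.1 hz, hch.2, fun z hz hzy a ha hza => ?_⟩
    obtain ⟨α, hα, rfl⟩ := mem_omega1.1 (pair_mem_prod.1 (mem_sep.1 hza).1).2
    exact h z hz hzy α hα (pair_mem_heightGraph.1 hza).2.2 ha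

theorem ExternalVia.exists_isAronszajnSubtree {θ : Cardinal.{u}} (hθ : θ.IsRegular)
    (hκθ : kappa ≤ θ) {R x N S : ZFSet.{u}} (hR : R ⊆ prod omega1 omega1)
    (hT : IsOmegaOneTree omega1 R) (hS : IsStationaryOf (H kappa) S) (hx : x ∈ omega1)
    (h : ExternalVia θ R x N S) : ∃ A, IsAronszajnSubtree omega1 R A := by
  by_contra hA
  obtain ⟨hN, hTN, hSN, hext⟩ := h
  obtain ⟨D, hDc, hDs, hD⟩ := exists_isDefFamily kappa_isRegular.{u}
  have hSH : ∀ a ∈ H kappa, ∃ M ∈ S, a ∈ M := fun a ha => by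
    obtain ⟨M, hMS, haM, -⟩ := hS.exists_isGood hR hDc ha
    exact ⟨M, hMS, haM⟩
  obtain ⟨g, hg, hgc⟩ := exists_seq_captured hR hT hS hDc hA
  have h0 : ℵ₀ < θ := aleph0_lt_kappa.trans_le hκθ
  have hmono : H kappa ⊆ H θ := H_mono hκθ
  have hSθ : S ∈ H θ := hN.subset_H hSN
  obtain ⟨t, ht, hSt, htc⟩ := id hSθ
  -- The bound on the size of `H κ` comes from `S ∈ H θ`: each element of `H κ` belongs to a member
  -- of `S`, hence to any transitive set that includes `S`.
  have hP : hset kappa ∈ H θ := ⟨t, ht, fun a ha => by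
    obtain ⟨M, hMS, haM⟩ := hSH a (mem_hset.1 ha)
    exact ht M (hSt hMS) haM, htc⟩
  have hnat (n : ℕ) : (n : Ordinal.{u}).toZFSet ∈ H θ := natCast_toZFSet_mem_H hθ n
  have hw : naturals ∈ H θ := by
    refine mem_H_of_countable hθ h0 ?_ ?_ <;> rw [naturals, coe_range]
    · rintro _ ⟨n, rfl⟩
      exact hnat n
    · exact Set.countable_range _
  have hf : seqGraph g ∈ H θ := by
    refine mem_H_of_countable hθ h0 ?_ ?_ <;> rw [seqGraph, coe_range]
    · rintro _ ⟨n, rfl⟩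
      exact pair_mem_H hθ (hnat n) (mem_H_of_mem hSθ (hg n).1)
    · exact Set.countable_range _
  have hDH : D ∈ H θ := mem_H_of_countable hθ h0 (fun d hd => mem_H_of_subset hP (hDs d hd)) hDc
  obtain ⟨O, R', P, w, D', hh, f, hfN, hc⟩ := hN.exists_capturedByCountable hTN hSN
    ⟨_, hmono omega1_mem_H, _, hmono (mem_H_of_subset_prod hR), _, hP, _, hw, _, hf, _, hDH, _,
      hmono (mem_H_of_subset_prod sep_subset), capturedByCountable_of_seq hT hS.1 hSH hD hg hgc⟩
  obtain ⟨hTO, hheight, hw, hfun, hD', hSP, hPS, hc⟩ := hc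
  obtain ⟨rfl, rfl⟩ := pair_inj.1 hTO
  -- The reflected `P` is the union of `S`, and so is `H κ`.
  obtain rfl : hset kappa = P := by
    ext a
    rw [mem_hset]
    constructor
    · intro ha
      obtain ⟨M, hMS, haM⟩ := hSH a ha
      exact hSP M hMS a haM
    · intro ha
      obtain ⟨M, hMS, haM⟩ := hPS a ha
      exact (hS.1 hMS).1 haM
  obtain ⟨n, hn, M, hMS, hnM, hTM, hTV, c, hcM, hcX, hch, hcap⟩ := hc x hx
  -- The index `n` and the sequence `f` are in `N`, so some value of `f` at `n` is; since `f` is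
  -- single-valued on `S`, that value is `M`.
  obtain ⟨M', hM'N, hM'S, hnM'⟩ :=
    hN.exists_pair_mem (hN.mem_of_natural hθ hw n hn) hSN hfN hMS hnM
  obtain rfl := hfun n hn M hMS M' hM'S hnM hnM'
  obtain ⟨hMH, hMc⟩ := hS.1 hMS
  refine hext M hMS hM'N ⟨hTV.isCountableModel kappa_isRegular hD' hMH hMc.le, hTM, c, hcM,
    ⟨fun z hz => hcX z hz, hch⟩, fun z hz hzx α hα hzα hαM => hcap z hz hzx _ hαM ?_⟩
  exact pair_toZFSet_mem hT hheight hα hz hzα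

/-! ### Aronszajn subtrees yield external nodes -/

instance : Countable (Σ n, setLanguage.Functions n) :=
  have : IsEmpty (Σ n, setLanguage.Functions n) := ⟨fun f => f.2.elim⟩
  inferInstance

instance : Countable (Σ n, setLanguage.Relations n) :=
  have : Subsingleton (Σ n, setLanguage.Relations n) :=
    ⟨by rintro ⟨_, ⟨⟩⟩ ⟨_, ⟨⟩⟩; rfl⟩
  inferInstance

theorem exists_isCountableModel {θ : Cardinal.{u}} (hθ : θ.IsRegular) {s : Set ZFSet.{u}}
    (hs : s.Countable) (hsH : s ⊆ H θ) : ∃ N, IsCountableModel θ N ∧ ∀ x ∈ s, x ∈ N := by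
  have hL : setLanguage.card ≤ ℵ₀ := by
    have : Countable setLanguage.Symbols :=
      inferInstanceAs (Countable ((Σ n, setLanguage.Functions n) ⊕ Σ n, setLanguage.Relations n))
    exact mk_le_aleph0
  have hinf : ℵ₀ ≤ #(H θ) := Cardinal.infinite_iff.1 (H_infinite hθ).to_subtype
  have hs' : (Subtype.val ⁻¹' s : Set (H θ)).Countable := hs.preimage Subtype.val_injective
  obtain ⟨E, hsE, hE⟩ := Language.exists_elementarySubstructure_card_eq setLanguage
    (Subtype.val ⁻¹' s : Set (H θ)) (ℵ₀ : Cardinal.{0}) le_rfl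
    (by simpa using! hs') (by simpa using hL) (by simpa using hinf)
  have hEc : (E : Set (H θ)).Countable := by
    rw [← le_aleph0_iff_set_countable]
    have : Cardinal.lift.{0} #E = ℵ₀ := by simpa using hE
    rw [Cardinal.lift_id'] at this
    exact this.le
  obtain ⟨N, hN, hNc⟩ := exists_of_countable (hEc.image Subtype.val)
  refine ⟨N, ⟨hNc, E, hN.symm⟩, fun x hx => ?_⟩
  rw [← SetLike.mem_coe, hN]
  exact ⟨⟨x, hsH hx⟩, hsE hx, rfl⟩

theorem IsAronszajnSubtree.exists_external {R A : ZFSet.{u}}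
    (hT : IsOmegaOneTree omega1 R) (hA : IsAronszajnSubtree omega1 R A) :
    ForLargeRegular (fun θ => ∃ x ∈ omega1, ∃ N, IsExternal θ R x N) := by
  obtain ⟨hAX, hAd, hAT, hAc⟩ := hA
  have hF : ∀ c : ZFSet.{u}, ∃ β < ω_ 1, IsTreeChain omega1 R c →
      ∀ y ∈ c, y ∈ A → ∀ α < ω_ 1, HasHeight omega1 R y α → α < β := by
    intro c
    by_cases hc : IsTreeChain omega1 R c
    · have hcc : (↑(c ∩ A) : Set ZFSet).Countable := card_le_aleph0_iff.1 (hAc _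
        ⟨fun z hz => (mem_inter.1 hz).2, fun y hy z hz => hc.2 y (mem_inter.1 hy).1 z
          (mem_inter.1 hz).1⟩)
      choose! ht hlt hht using hT.exists_height
      obtain ⟨β, hβ, h⟩ := exists_countable_bound (hcc.image ht) (by
        rintro _ ⟨y, hy, rfl⟩
        exact hlt y (hAX (mem_inter.1 hy).2))
      refine ⟨β, hβ, fun _ y hyc hyA α _ hyα => ?_⟩
      rw [hyα.unique hT.isTree (hAX hyA) (hht y (hAX hyA))]
      exact h _ ⟨y, mem_inter.2 ⟨hyc, hyA⟩, rfl⟩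
    -- For sets that are not chains the bound is irrelevant, and `0` is a default value.
    · exact ⟨0, omega_pos 1, fun h => (hc h).elim⟩
  choose β hβ hβc using hF
  have hclub := isClubOf_closed (X := H kappa) (Φ := {fun c _ => (β c).toZFSet})
    (Set.countable_singleton _) (by
      rintro F rfl c - _ -
      exact toZFSet_mem_H_of_lt (hβ c))
  have : Small.{u} ((powerset (hset kappa) : ZFSet.{u}) : Set ZFSet.{u}) := ZFSet.small_coe _
  -- The club has to be a set in order to be an element of `N`; it is included in the power set of
  -- `H κ`.
  have : Small.{u} {a | a ∈ countableSubsets (H kappa) ∧ ∀ F ∈ ({fun c _ => (β c).toZFSet} :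
      Set (ZFSet.{u} → ZFSet.{u} → ZFSet.{u})), ∀ x ∈ a, ∀ y ∈ a, F x y ∈ a} :=
    small_subset (s := ((powerset (hset kappa) : ZFSet.{u}) : Set ZFSet.{u})) fun a ha =>
      mem_powerset.2 fun z hz => mem_hset.2 (ha.1.1 hz)
  obtain ⟨S, hS⟩ := exists_coe_eq {a | a ∈ countableSubsets (H kappa) ∧
    ∀ F ∈ ({fun c _ => (β c).toZFSet} : Set (ZFSet.{u} → ZFSet.{u} → ZFSet.{u})),
      ∀ x ∈ a, ∀ y ∈ a, F x y ∈ a}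
  rw [← hS] at hclub
  have hSβ : ∀ M ∈ S, ∀ c ∈ M, (β c).toZFSet ∈ M := by
    intro M hM c hc
    rw [← SetLike.mem_coe, hS] at hM
    exact hM.2 _ rfl c hc c hc
  obtain ⟨μ, hμ⟩ := exists_forall_mem_H (pair S (treeOn R))
  refine ⟨μ, fun θ hμθ hθ => ?_⟩
  have hST := hμ θ hμθ
  obtain ⟨N, hN, hsN⟩ := exists_isCountableModel hθ (s := {S, treeOn R}) (Set.to_countable _) (by
    rintro _ (rfl | rfl)
    exacts [fst_mem_H hST, snd_mem_H hST])
  have hSN : S ∈ N := hsN _ (by simp)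
  have hTN : treeOn R ∈ N := hsN _ (by simp)
  have hNc : (N : Set ZFSet).Countable := card_le_aleph0_iff.1 hN.1
  -- Both `N ∩ S` and its members are countable, so one level lies above all countable ordinals in
  -- these members.
  obtain ⟨γ, hγ, hγN⟩ := exists_countable_bound
    (s := ⋃ M ∈ (↑(N ∩ S) : Set ZFSet.{u}), {α : Ordinal.{u} | α < ω_ 1 ∧ α.toZFSet ∈ M}) (by
      refine Set.Countable.biUnion (hNc.mono fun M hM => (mem_inter.1 hM).1) fun M hM => ?_
      have hMc : (M : Set ZFSet).Countable :=
        (card_eq_aleph0_iff.1 (hclub.subset (mem_inter.1 hM).2).2).1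
      exact (hMc.preimage toZFSet_injective).mono fun _ h => h.2) (by
      intro α hα
      simp only [Set.mem_iUnion] at hα
      obtain ⟨M, -, h⟩ := hα
      exact h.1)
  obtain ⟨x, hxA, hxγ⟩ := hAT.level_nonempty γ hγ
  rw [hasHeight_iff_of_subset hAX hAd hxA] at hxγ
  refine ⟨x, hAX hxA, N, S, hclub, hN, hTN, hSN, fun M hMS hMN hcap => ?_⟩
  obtain ⟨-, -, c, hcM, hch, hc⟩ := hcap
  have hβM := hSβ M hMS c hcM
  have hβγ : β c < γ := hγN _ (Set.mem_biUnion (mem_inter.2 ⟨hMN, hMS⟩) ⟨hβ c, hβM⟩)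
  -- The node at height exactly `β c` lies in `c`, as `β c ∈ M`, and in `A`, which is downward
  -- closed; so its height would be less than `β c`.
  obtain ⟨y, hy, hyx, hyβ⟩ := hxγ.exists_below hT.isTree (hAX hxA) hβγ
  exact lt_irrefl _ (hβc c hch y (hc y hy (Or.inr hyx) _ (hβ c) hyβ hβM) (hAd x hxA y hy hyx) _
    (hβ c) hyβ)

/-- A property of all large enough regular cardinals holds at one that is at least `(2^{ω₁})⁺`. -/
theorem ForLargeRegular.exists_ge {P : Cardinal.{u} → Prop} (h : ForLargeRegular P) :
    ∃ θ, kappa ≤ θ ∧ θ.IsRegular ∧ P θ := by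
  obtain ⟨θ₀, h⟩ := h
  have hκ : kappa ≤ Order.succ (max θ₀ kappa) := (le_max_right _ _).trans (Order.le_succ _)
  have hr : (Order.succ (max θ₀ kappa)).IsRegular :=
    isRegular_succ (aleph0_lt_kappa.le.trans (le_max_right _ _))
  exact ⟨_, hκ, hr, h _ ((le_max_left _ _).trans (Order.le_succ _)) hr⟩


end AronszajnSubtrees

open AronszajnSubtrees
theorem mainTheorem7 (R : ZFSet.{u}) (hR : R ⊆ ZFSet.prod omega1 omega1)
    (hT : IsOmegaOneTree omega1 R) :
    (∀ S : ZFSet.{u}, IsStationaryOf (H kappa) S →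
      ForLargeRegular (fun θ => ∃ x ∈ omega1, ∃ N, ExternalVia θ R x N S) →
        ∃ A, IsAronszajnSubtree omega1 R A) ∧
    List.TFAE
      [∃ A, IsAronszajnSubtree omega1 R A,
        ForLargeRegular (fun θ => ∃ x ∈ omega1, ∃ N, IsExternal θ R x N),
        ForLargeRegular (fun θ => ∃ x ∈ omega1, ∃ N, IsWeaklyExternal θ R x N)] := by
  refine ⟨fun S hS h => ?_, ?_⟩
  · obtain ⟨θ, hκθ, hθ, x, hx, N, hN⟩ := h.exists_ge
    exact hN.exists_isAronszajnSubtree hθ hκθ hR hT hS hx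
  · tfae_have 1 → 2 := fun ⟨A, hA⟩ => hA.exists_external hT
    tfae_have 2 → 3 := by
      rintro ⟨θ₀, h⟩
      refine ⟨θ₀, fun θ hθ₀ hθ => ?_⟩
      obtain ⟨x, hx, N, S, hS, hN⟩ := h θ hθ₀ hθ
      exact ⟨x, hx, N, S, hS.isStationaryOf (H_infinite kappa_isRegular), hN⟩
    tfae_have 3 → 1 := by
      intro h
      obtain ⟨θ, hκθ, hθ, x, hx, N, S, hS, hN⟩ := h.exists_ge
      exact hN.exists_isAronszajnSubtree hθ hκθ hR hT hS hx
    tfae_finish
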